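/- Let $\log$ be the logarithm to base $2$, and let all Hilbert spaces be finite-dimensional. For a state $\rho$ of a bipartite system $A\otimes B$ and a class $\mathsf M$ of measurements on it, put \[ E_{r,\mathsf M}(\rho) := \inf_{\sigma}\ \sup_{\{M_i\}\in\mathsf M} D\bigl((\operatorname{tr}\rho M_i)_i \,\big\|\, (\operatorname{tr}\sigma M_i)_i\bigr), \] where $\sigma$ ranges over the separable states $\sum_j p_j\,\sigma_j^A\otimes\sigma_j^B$ of $A\otimes B$, measurements are POVMs with finitely many outcomes, and $D(p\|q)=\sum_i p_i\log(p_i/q_i)$ if $\operatorname{supp}p\subseteq\operatorname{supp}q$ and $D(p\|q)=+\infty$ otherwise. Let $\mathsf M$ be any of the classes $\mathsf{LO}$ (product measurements $\{R_k\otimes S_l\}_{k,l}$ of local POVMs), $\mathsf{1\text{-}LOCC}$ (measurements implemented by local operations and one-way classical communication from $A$ to $B$), $\mathsf{LOCC}$ (measurements implemented by local operations and finitely many rounds of two-way classical communication), $\mathsf{SEP}$ (POVMs with separable elements $\sum_j P_j\otimes Q_j$, $P_j,Q_j\ge 0$) and $\mathsf{PPT}$ (POVMs whose elements have positive semidefinite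 partial transpose). 1. For every integer $d\ge 1$ and the rank-$d$ maximally entangled state $\Phi_d=|\phi\rangle\langle\phi|$ on $\mathbb C^d\otimes\mathbb C^d$, $|\phi\rangle=\frac1{\sqrt d}\sum_{i=1}^d|i\rangle\otimes|i\rangle$, \[ E_{r,\mathsf M}(\Phi_d)=\log(d+1)-1 \quad\text{for each } \mathsf M\in\{\mathsf{LO},\mathsf{1\text{-}LOCC},\mathsf{LOCC},\mathsf{SEP},\mathsf{PPT}\}. \] 2. For every pure state $\psi$ of a bipartite system $A\otimes B$ and each of these $\mathsf M$, the limit \[ E^\infty_{r,\mathsf M}(\psi):=\lim_{n\to\infty}\tfrac1n E_{r,\mathsf M}(\psi^{\otimes n}) \] exists, where $\psi^{\otimes n}$ is regarded as a bipartite state of $A^{\otimes n}$ and $B^{\otimes n}$, and it equals the entropy of entanglement $S(\operatorname{tr}_B\psi)$, with $S(\rho)=-\operatorname{tr}\rho\log\rho$. -/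

import Mathlib

open Matrix Filter Topology
open scoped Kronecker ComplexOrder

noncomputable section

/-- A density matrix: positive semidefinite with unit trace. -/
def IsDensity {n : Type} [Fintype n] (ρ : Matrix n n ℂ) : Prop :=
  ρ.PosSemidef ∧ ρ.trace = 1

/-- A positive operator valued measure `{M_i}` on the Hilbert space `ℂ^n`. -/
def IsPOVM {n ι : Type} [DecidableEq n] [Fintype ι] (M : ι → Matrix n n ℂ) : Prop :=
  (∀ i, (M i).PosSemidef) ∧ ∑ i, M i = 1

/-- The outcome distribution `i ↦ tr (ω M_i)` of the measurement `{M_i}` in the state `ω`. -/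
def outcomeDist {n ι : Type} [Fintype n] (M : ι → Matrix n n ℂ) (ω : Matrix n n ℂ) (i : ι) : ℝ :=
  (ω * M i).trace.re

open Classical in
/-- Relative entropy (base 2) of finite probability vectors: `∑ p_i log (p_i / q_i)` if the
support of `p` is contained in that of `q`, and `+∞` otherwise. -/
def relEntropy {ι : Type} [Fintype ι] (p q : ι → ℝ) : EReal :=
  if ∀ i, q i = 0 → p i = 0 then ((∑ i, p i * Real.logb 2 (p i / q i) : ℝ) : EReal) else ⊤

/-- Von Neumann entropy (base 2), `S(ρ) = - tr (ρ log ρ)`. -/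
def vonNeumannEntropy {n : Type} [Fintype n] [DecidableEq n] (ρ : Matrix n n ℂ) : ℝ :=
  -(ρ * cfc (Real.logb 2) ρ).trace.re

/-! ### Bipartite systems `ℂ^A ⊗ ℂ^B` -/

/-- The partial trace over the second system. -/
def traceB {A B : Type} [Fintype B] (ρ : Matrix (A × B) (A × B) ℂ) : Matrix A A ℂ :=
  Matrix.of fun a a' => ∑ b, ρ (a, b) (a', b)

/-- The partial transpose, taken on the second system. -/
def partialTranspose {A B : Type} (M : Matrix (A × B) (A × B) ℂ) : Matrix (A × B) (A × B) ℂ :=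
  Matrix.of fun x y => M (x.1, y.2) (y.1, x.2)

/-- Separable states `∑ p_j σ_j^A ⊗ σ_j^B`. -/
def IsSeparableState {A B : Type} [Fintype A] [Fintype B]
    (σ : Matrix (A × B) (A × B) ℂ) : Prop :=
  ∃ (m : ℕ) (p : Fin m → ℝ) (α : Fin m → Matrix A A ℂ) (β : Fin m → Matrix B B ℂ),
    (∀ j, 0 ≤ p j) ∧ ∑ j, p j = 1 ∧ (∀ j, IsDensity (α j)) ∧ (∀ j, IsDensity (β j)) ∧
      σ = ∑ j, (p j : ℂ) • (α j ⊗ₖ β j)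

/-- Separable (not normalized) positive operators `∑ P_j ⊗ Q_j` with `P_j, Q_j ≥ 0`. -/
def IsSeparableOp {A B : Type} (T : Matrix (A × B) (A × B) ℂ) : Prop :=
  ∃ (m : ℕ) (P : Fin m → Matrix A A ℂ) (Q : Fin m → Matrix B B ℂ),
    (∀ j, (P j).PosSemidef) ∧ (∀ j, (Q j).PosSemidef) ∧ T = ∑ j, P j ⊗ₖ Q j

/-! ### Restricted classes of measurements -/

/-- Local measurements: Alice and Bob independently measure POVMs `{R_k}` and `{S_l}`; the
outcome is the pair `(k, l)` (labelled by `ι` through the bijection `e`). -/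
def IsLO {A B ι : Type} [DecidableEq A] [DecidableEq B]
    (M : ι → Matrix (A × B) (A × B) ℂ) : Prop :=
  ∃ (r s : ℕ) (R : Fin r → Matrix A A ℂ) (S : Fin s → Matrix B B ℂ) (e : ι ≃ Fin r × Fin s),
    IsPOVM R ∧ IsPOVM S ∧ ∀ i, M i = R (e i).1 ⊗ₖ S (e i).2

/-- One-way LOCC measurements: Alice measures a POVM `{R_k}` and sends the outcome `k` to Bob,
who measures a POVM `{S_{k,l}}_l` that may depend on `k` and outputs a function `f k l`. -/
def IsOneLOCC {A B ι : Type} [DecidableEq A] [DecidableEq B] [DecidableEq ι]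
    (M : ι → Matrix (A × B) (A × B) ℂ) : Prop :=
  ∃ (r : ℕ) (s : Fin r → ℕ) (R : Fin r → Matrix A A ℂ)
    (S : ∀ k, Fin (s k) → Matrix B B ℂ) (f : ∀ k, Fin (s k) → ι),
    IsPOVM R ∧ (∀ k, IsPOVM (S k)) ∧
      ∀ i, M i = ∑ k, ∑ l, if f k l = i then R k ⊗ₖ S k l else 0

/-- LOCC measurements: those implemented by a protocol with finitely many rounds. In each round
one party applies a quantum instrument (`K x y` are the Kraus operators of the branch `x`, with
an output system that may depend on `x`) and announces the classical outcome `x`; the parties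
then continue with an LOCC measurement `N x` of what they hold. The transcript of the protocol
may be processed classically. -/
inductive IsLOCC : ∀ {A B ι : Type} [Fintype A] [DecidableEq A] [Fintype B] [DecidableEq B],
    (ι → Matrix (A × B) (A × B) ℂ) → Prop
  | halt {A B : Type} [Fintype A] [DecidableEq A] [Fintype B] [DecidableEq B] :
      IsLOCC (fun _ : Unit => (1 : Matrix (A × B) (A × B) ℂ))
  | alice {A B X : Type} [Fintype A] [DecidableEq A] [Fintype B] [DecidableEq B] [Fintype X]
      {Y A' ι : X → Type} [∀ x, Fintype (Y x)] [∀ x, Fintype (A' x)] [∀ x, DecidableEq (A' x)]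
      (K : ∀ x, Y x → Matrix (A' x) A ℂ) (hK : ∑ x, ∑ y, (K x y)ᴴ * K x y = 1)
      (N : ∀ x, ι x → Matrix (A' x × B) (A' x × B) ℂ) (hN : ∀ x, IsLOCC (N x)) :
      IsLOCC (fun i : Σ x, ι x =>
        ∑ y, (K i.1 y ⊗ₖ (1 : Matrix B B ℂ))ᴴ * N i.1 i.2 * (K i.1 y ⊗ₖ (1 : Matrix B B ℂ)))
  | bob {A B X : Type} [Fintype A] [DecidableEq A] [Fintype B] [DecidableEq B] [Fintype X]
      {Y B' ι : X → Type} [∀ x, Fintype (Y x)] [∀ x, Fintype (B' x)] [∀ x, DecidableEq (B' x)]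
      (K : ∀ x, Y x → Matrix (B' x) B ℂ) (hK : ∑ x, ∑ y, (K x y)ᴴ * K x y = 1)
      (N : ∀ x, ι x → Matrix (A × B' x) (A × B' x) ℂ) (hN : ∀ x, IsLOCC (N x)) :
      IsLOCC (fun i : Σ x, ι x =>
        ∑ y, ((1 : Matrix A A ℂ) ⊗ₖ K i.1 y)ᴴ * N i.1 i.2 * ((1 : Matrix A A ℂ) ⊗ₖ K i.1 y))
  | postprocess {A B ι κ : Type} [Fintype A] [DecidableEq A] [Fintype B] [DecidableEq B]
      [Fintype ι] [DecidableEq κ] (M : ι → Matrix (A × B) (A × B) ℂ) (hM : IsLOCC M)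
      (f : ι → κ) : IsLOCC (fun j => ∑ i, if f i = j then M i else 0)

/-- POVMs whose elements are separable. -/
def IsSEP {A B ι : Type} [DecidableEq A] [DecidableEq B] [Fintype ι]
    (M : ι → Matrix (A × B) (A × B) ℂ) : Prop :=
  IsPOVM M ∧ ∀ i, IsSeparableOp (M i)

/-- POVMs whose elements have positive partial transpose. -/
def IsPPT {A B ι : Type} [DecidableEq A] [DecidableEq B] [Fintype ι]
    (M : ι → Matrix (A × B) (A × B) ℂ) : Prop :=
  IsPOVM M ∧ ∀ i, (partialTranspose (M i)).PosSemidef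

/-- Names of the five classes of measurements. -/
inductive MeasClass : Type
  | LO | oneLOCC | LOCC | SEP | PPT

/-- The measurements (with finitely many outcomes) that belong to a class. -/
def MeasClass.Mem {A B : Type} [Fintype A] [DecidableEq A] [Fintype B] [DecidableEq B] {k : ℕ}
    (M : Fin k → Matrix (A × B) (A × B) ℂ) : MeasClass → Prop
  | .LO => IsLO M
  | .oneLOCC => IsOneLOCC M
  | .LOCC => IsLOCC M
  | .SEP => IsSEP M
  | .PPT => IsPPT M

/-- The relative entropy of entanglement `E_{r,C}(ρ)` with respect to the separable states and
the class `C` of measurements: `inf_σ sup_M D(M(ρ) ‖ M(σ))`. -/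
def measuredREE {A B : Type} [Fintype A] [DecidableEq A] [Fintype B] [DecidableEq B]
    (C : MeasClass) (ρ : Matrix (A × B) (A × B) ℂ) : EReal :=
  ⨅ (σ : Matrix (A × B) (A × B) ℂ) (_ : IsSeparableState σ),
    ⨆ (k : ℕ) (M : Fin k → Matrix (A × B) (A × B) ℂ) (_ : C.Mem M),
      relEntropy (outcomeDist M ρ) (outcomeDist M σ)

/-! ### States -/

/-- The density matrix `|ψ⟩⟨ψ|`. -/
def pureState {n : Type} (ψ : n → ℂ) : Matrix n n ℂ :=
  vecMulVec ψ (star ψ)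

/-- The rank-`d` maximally entangled state on `ℂ^d ⊗ ℂ^d`, with vector
`d^{-1/2} ∑ |i⟩ ⊗ |i⟩`. -/
def maxEntangled (d : ℕ) : Matrix (Fin d × Fin d) (Fin d × Fin d) ℂ :=
  pureState fun x => if x.1 = x.2 then ((1 / Real.sqrt d : ℝ) : ℂ) else 0

/-- The state `ρ^{⊗ n}`, as a bipartite state of `A^n` and `B^n`. -/
def tensorPower {A B : Type} (ρ : Matrix (A × B) (A × B) ℂ) (n : ℕ) :
    Matrix ((Fin n → A) × (Fin n → B)) ((Fin n → A) × (Fin n → B)) ℂ :=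
  Matrix.of fun x y => ∏ t, ρ (x.1 t, x.2 t) (y.1 t, y.2 t)

end

noncomputable section

/-! ### Inclusions between the classes of measurements -/

section Inclusions

variable {A B A' B' : Type}

/-! Every class contains the local measurements and is contained in the PPT ones
(`MeasClass.mem_of_isLO`, `MeasClass.Mem.isPPT`). Upper bounds are therefore proved against all PPT
measurements for one well-chosen separable state, and lower bounds with a local measurement adapted
to an arbitrary separable state; the class then plays no further role.

Upper bounds. For `Φ_d` the separable state is the isotropic state `(1 + d Φ_d) / (d (d + 1))`. If
`M` has positive partial transpose, then `tr (M d Φ_d) ≤ tr M`, because partial transposition turns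
`d Φ_d` into the swap, which is at most `1`. Hence each outcome probability of `Φ_d` is at most `(d
+ 1) / 2` times that of the isotropic state (`measuredREE_maxEntangled_le`). For a general pure
state the separable state is its pinching in a Schmidt basis, and the measured relative entropy is
at most the Shannon entropy of the Schmidt weights (`IsSchmidt.measuredREE_le`). This is an instance
of data processing, proved by hand: Kadison's inequality gives a comparison of resolvent sums at
every `t > 0`, and integrating in `t` gives the logarithms.

Lower bound. Given a separable `σ`, take among all Schmidt decompositions one minimizing `∑ ⟨a_k
b_k|σ|a_k b_k⟩`, and let both parties measure in its bases. With `s_kl = ⟨a_k b_l|σ|a_k b_l⟩`,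
optimality under rotations of two terms of equal weight, together with the positive partial
transpose of `σ`, gives `s_ii + s_jj ≤ 2 (s_ij + s_ji)` (`IsSchmidt.diag_add_diag_le`). Summing over
pairs yields `∑ (m_k + 1) / 2 * s_kk ≤ 1`, where `m_k` is the multiplicity of the weight `λ_k`, and
Gibbs' inequality turns this into the bound `∑ λ_k log ((m_k + 1) / 2)`
(`IsSchmidt.le_measuredREE`).

For `Φ_d` all multiplicities are `d`, and the bounds coincide. For `ψ^{⊗ n}` a weight depends only
on how often each factor occurs, so there are polynomially many distinct weights and the lower bound
is within `O(log n)` of the entropy; after division by `n` the gap vanishes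
(`IsSchmidt.tendsto_measuredREE`). -/

theorem partialTranspose_kronecker (P : Matrix A A ℂ) (Q : Matrix B B ℂ) :
    partialTranspose (P ⊗ₖ Q) = P ⊗ₖ Qᵀ := by
  ext x y
  simp [partialTranspose, kroneckerMap_apply]

theorem partialTranspose_sum {ι : Type*} (s : Finset ι) (M : ι → Matrix (A × B) (A × B) ℂ) :
    partialTranspose (∑ i ∈ s, M i) = ∑ i ∈ s, partialTranspose (M i) := by
  ext x y
  simp [partialTranspose, Matrix.sum_apply]

theorem partialTranspose_one [DecidableEq A] [DecidableEq B] :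
    partialTranspose (1 : Matrix (A × B) (A × B) ℂ) = 1 := by
  rw [← one_kronecker_one, partialTranspose_kronecker, transpose_one]

theorem partialTranspose_zero : partialTranspose (0 : Matrix (A × B) (A × B) ℂ) = 0 := by
  ext x y
  simp [partialTranspose]

theorem conjTranspose_kronecker_one_mul_mul_apply [Fintype B] [Fintype A'] [DecidableEq B]
    (K : Matrix A' A ℂ)
    (N : Matrix (A' × B) (A' × B) ℂ) (x y : A × B) :
    ((K ⊗ₖ (1 : Matrix B B ℂ))ᴴ * N * (K ⊗ₖ (1 : Matrix B B ℂ))) x y =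
      ∑ a, ∑ a', star (K a' x.1) * N (a', x.2) (a, y.2) * K a y.1 := by
  simp only [Matrix.mul_apply, conjTranspose_apply, kroneckerMap_apply, Fintype.sum_prod_type,
    Matrix.one_apply, star_mul', Finset.sum_mul, apply_ite star, star_one, star_zero]
  simp

theorem conjTranspose_one_kronecker_mul_mul_apply [Fintype A] [Fintype B'] [DecidableEq A]
    (K : Matrix B' B ℂ)
    (N : Matrix (A × B') (A × B') ℂ) (x y : A × B) :
    (((1 : Matrix A A ℂ) ⊗ₖ K)ᴴ * N * ((1 : Matrix A A ℂ) ⊗ₖ K)) x y =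
      ∑ b, ∑ b', star (K b' x.2) * N (x.1, b') (y.1, b) * K b y.2 := by
  simp only [Matrix.mul_apply, conjTranspose_apply, kroneckerMap_apply, Fintype.sum_prod_type,
    Matrix.one_apply, star_mul', Finset.sum_mul, apply_ite star, star_one, star_zero]
  simp

theorem partialTranspose_conj_kronecker_one [Fintype B] [Fintype A'] [DecidableEq B]
    (K : Matrix A' A ℂ)
    (N : Matrix (A' × B) (A' × B) ℂ) :
    partialTranspose ((K ⊗ₖ (1 : Matrix B B ℂ))ᴴ * N * (K ⊗ₖ (1 : Matrix B B ℂ))) =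
      (K ⊗ₖ (1 : Matrix B B ℂ))ᴴ * partialTranspose N * (K ⊗ₖ (1 : Matrix B B ℂ)) := by
  ext x y
  rw [conjTranspose_kronecker_one_mul_mul_apply]
  simp only [partialTranspose, of_apply, conjTranspose_kronecker_one_mul_mul_apply]

/-- The transpose acts on the second factor, so a Kraus operator of Bob is replaced by its entrywise
conjugate. The result is still a congruence and preserves positivity. -/
theorem partialTranspose_conj_one_kronecker [Fintype A] [Fintype B'] [DecidableEq A]
    (K : Matrix B' B ℂ)
    (N : Matrix (A × B') (A × B') ℂ) :
    partialTranspose (((1 : Matrix A A ℂ) ⊗ₖ K)ᴴ * N * ((1 : Matrix A A ℂ) ⊗ₖ K)) =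
      ((1 : Matrix A A ℂ) ⊗ₖ K.map star)ᴴ * partialTranspose N *
        ((1 : Matrix A A ℂ) ⊗ₖ K.map star) := by
  ext x y
  rw [conjTranspose_one_kronecker_mul_mul_apply]
  simp only [partialTranspose, of_apply, conjTranspose_one_kronecker_mul_mul_apply, map_apply,
    star_star]
  rw [Finset.sum_comm]
  exact Finset.sum_congr rfl fun _ _ => Finset.sum_congr rfl fun _ _ => by ring

theorem sum_conj_kronecker_one {X : Type} {Y A' : X → Type}
    [DecidableEq A] [Fintype B] [DecidableEq B]
    [Fintype X] [∀ x, Fintype (Y x)] [∀ x, Fintype (A' x)]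
    (K : ∀ x, Y x → Matrix (A' x) A ℂ) (hK : ∑ x, ∑ y, (K x y)ᴴ * K x y = 1) :
    ∑ x, ∑ y, (K x y ⊗ₖ (1 : Matrix B B ℂ))ᴴ * (K x y ⊗ₖ (1 : Matrix B B ℂ)) = 1 := by
  have h : ∀ x y, (K x y ⊗ₖ (1 : Matrix B B ℂ))ᴴ * (K x y ⊗ₖ (1 : Matrix B B ℂ)) =
      ((K x y)ᴴ * K x y) ⊗ₖ (1 : Matrix B B ℂ) := fun x y => by
    rw [conjTranspose_kronecker, ← mul_kronecker_mul, conjTranspose_one, one_mul]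
  simp_rw [h]
  rw [← one_kronecker_one, ← hK]
  ext u v
  simp [kroneckerMap_apply, Matrix.sum_apply, Finset.sum_mul]

theorem sum_conj_one_kronecker {X : Type} {Y B' : X → Type}
    [Fintype A] [DecidableEq A] [DecidableEq B]
    [Fintype X] [∀ x, Fintype (Y x)] [∀ x, Fintype (B' x)]
    (K : ∀ x, Y x → Matrix (B' x) B ℂ) (hK : ∑ x, ∑ y, (K x y)ᴴ * K x y = 1) :
    ∑ x, ∑ y, ((1 : Matrix A A ℂ) ⊗ₖ K x y)ᴴ * ((1 : Matrix A A ℂ) ⊗ₖ K x y) = 1 := by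
  have h : ∀ x y, ((1 : Matrix A A ℂ) ⊗ₖ K x y)ᴴ * ((1 : Matrix A A ℂ) ⊗ₖ K x y) =
      (1 : Matrix A A ℂ) ⊗ₖ ((K x y)ᴴ * K x y) := fun x y => by
    rw [conjTranspose_kronecker, ← mul_kronecker_mul, conjTranspose_one, one_mul]
  simp_rw [h]
  rw [← one_kronecker_one, ← hK]
  ext u v
  simp [kroneckerMap_apply, Matrix.sum_apply, Finset.mul_sum]

end Inclusions

/-- A finitely supported family of positive operators with positive partial transposes that sums
to the identity; the type of outcomes may be infinite. -/
def IsFinitelySupportedPPT {A B ι : Type} [DecidableEq A] [DecidableEq B]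
    (M : ι → Matrix (A × B) (A × B) ℂ) : Prop :=
  (∀ i, (M i).PosSemidef) ∧ (∀ i, (partialTranspose (M i)).PosSemidef) ∧
    ∃ s : Finset ι, (∀ i, i ∉ s → M i = 0) ∧ ∑ i ∈ s, M i = 1

/-- Composing a Kraus family with finitely supported PPT measurements of the branches. -/
theorem IsFinitelySupportedPPT.sigma {A B X : Type} {Y A' B' ι : X → Type} [Fintype A]
    [DecidableEq A] [Fintype B] [DecidableEq B] [Fintype X] [∀ x, Fintype (Y x)]
    [∀ x, Fintype (A' x)] [∀ x, DecidableEq (A' x)] [∀ x, Fintype (B' x)]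
    [∀ x, DecidableEq (B' x)] (L L' : ∀ x, Y x → Matrix (A' x × B' x) (A × B) ℂ)
    (hL : ∑ x, ∑ y, (L x y)ᴴ * L x y = 1)
    (hL' : ∀ x y (N : Matrix (A' x × B' x) (A' x × B' x) ℂ), partialTranspose ((L x y)ᴴ * N * L x y) =
      (L' x y)ᴴ * partialTranspose N * L' x y)
    (N : ∀ x, ι x → Matrix (A' x × B' x) (A' x × B' x) ℂ)
    (hN : ∀ x, IsFinitelySupportedPPT (N x)) :
    IsFinitelySupportedPPT (fun i : Σ x, ι x =>
      ∑ y, (L i.1 y)ᴴ * N i.1 i.2 * L i.1 y) := by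
  choose h1 h2 s h3 h4 using hN
  refine ⟨fun i => posSemidef_sum _ fun y _ => (h1 i.1 i.2).conjTranspose_mul_mul_same _,
    fun i => ?_, Finset.univ.sigma s, fun i hi => ?_, ?_⟩
  · rw [partialTranspose_sum]
    refine posSemidef_sum _ fun y _ => ?_
    rw [hL']
    exact (h2 i.1 i.2).conjTranspose_mul_mul_same _
  · have : N i.1 i.2 = 0 := h3 _ _ (by simpa using hi)
    simp [this]
  · rw [Finset.sum_sigma, ← hL]
    refine Finset.sum_congr rfl fun x _ => ?_
    have hcomm : ∑ i ∈ s x, ∑ y, (L x y)ᴴ * N x i * L x y =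
        ∑ y, ∑ i ∈ s x, (L x y)ᴴ * N x i * L x y := Finset.sum_comm
    refine hcomm.trans (Finset.sum_congr rfl fun y _ => ?_)
    rw [← Matrix.sum_mul, ← Matrix.mul_sum, h4, Matrix.mul_one]

/-- The outcome types inside a protocol carry no `Fintype` structure, so the induction cannot run on
`IsPPT` itself. Finite support is what makes the sum over outcomes meaningful at each node. -/
theorem IsLOCC.isFinitelySupportedPPT {A B ι : Type} [Fintype A] [DecidableEq A] [Fintype B]
    [DecidableEq B] {M : ι → Matrix (A × B) (A × B) ℂ} (hM : IsLOCC M) :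
    IsFinitelySupportedPPT M := by
  induction hM with
  | halt =>
    refine ⟨fun _ => PosSemidef.one, fun _ => ?_, Finset.univ, by simp, by simp⟩
    rw [partialTranspose_one]
    exact PosSemidef.one
  | alice K hK N hN ih =>
    exact .sigma _ (fun x y => K x y ⊗ₖ 1) (sum_conj_kronecker_one K hK)
      (fun x y N => partialTranspose_conj_kronecker_one _ _) N ih
  | bob K hK N hN ih =>
    exact .sigma _ (fun x y => 1 ⊗ₖ (K x y).map star) (sum_conj_one_kronecker K hK)
      (fun x y N => partialTranspose_conj_one_kronecker _ _) N ih
  | postprocess M hM f ih =>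
    obtain ⟨h1, h2, s, h3, h4⟩ := ih
    refine ⟨fun j => posSemidef_sum _ fun i _ => ?_, fun j => ?_, Finset.univ.image f,
      fun j hj => ?_, ?_⟩
    · split_ifs
      exacts [h1 i, PosSemidef.zero]
    · rw [partialTranspose_sum]
      refine posSemidef_sum _ fun i _ => ?_
      split_ifs
      exacts [h2 i, by rw [partialTranspose_zero]; exact PosSemidef.zero]
    · refine Finset.sum_eq_zero fun i _ => if_neg fun h => hj ?_
      exact Finset.mem_image.2 ⟨i, Finset.mem_univ _, h⟩
    · rw [Finset.sum_comm, ← h4]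
      refine Eq.trans ?_ (Finset.sum_subset (Finset.subset_univ s) fun i _ hi => h3 i hi).symm
      refine Finset.sum_congr rfl fun i _ => ?_
      rw [Finset.sum_ite_eq, if_pos (Finset.mem_image_of_mem _ (Finset.mem_univ _))]

theorem IsLOCC.isPPT {A B ι : Type} [Fintype A] [DecidableEq A] [Fintype B] [DecidableEq B]
    [Fintype ι] {M : ι → Matrix (A × B) (A × B) ℂ} (hM : IsLOCC M) : IsPPT M := by
  obtain ⟨h1, h2, s, h3, h4⟩ := hM.isFinitelySupportedPPT
  refine ⟨⟨h1, ?_⟩, h2⟩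
  rw [← h4]
  exact (Finset.sum_subset (Finset.subset_univ s) fun i _ hi => h3 i hi).symm

theorem IsSEP.isPPT {A B ι : Type} [Fintype A] [DecidableEq A] [Fintype B] [DecidableEq B]
    [Fintype ι] {M : ι → Matrix (A × B) (A × B) ℂ} (hM : IsSEP M) : IsPPT M := by
  refine ⟨hM.1, fun i => ?_⟩
  obtain ⟨m, P, Q, hP, hQ, h⟩ := hM.2 i
  rw [h, partialTranspose_sum]
  refine posSemidef_sum _ fun j _ => ?_
  rw [partialTranspose_kronecker]
  exact (hP j).kronecker (hQ j).transpose

theorem IsLO.isOneLOCC {A B ι : Type} [DecidableEq A] [DecidableEq B] [DecidableEq ι]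
    {M : ι → Matrix (A × B) (A × B) ℂ} (hM : IsLO M) : IsOneLOCC M := by
  obtain ⟨r, s, R, S, e, hR, hS, h⟩ := hM
  refine ⟨r, fun _ => s, R, fun _ => S, fun k l => e.symm (k, l), hR, fun _ => hS, fun i => ?_⟩
  rw [h i, ← Fintype.sum_prod_type' (f := fun k l =>
    if e.symm (k, l) = i then R k ⊗ₖ S l else 0)]
  simp [Equiv.symm_apply_eq]

theorem IsLO.isSEP {A B ι : Type} [Fintype A] [Fintype B] [DecidableEq A] [DecidableEq B]
    [Fintype ι] {M : ι → Matrix (A × B) (A × B) ℂ} (hM : IsLO M) : IsSEP M := by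
  obtain ⟨r, s, R, S, e, hR, hS, h⟩ := hM
  refine ⟨⟨fun i => ?_, ?_⟩, fun i => ⟨1, fun _ => R (e i).1, fun _ => S (e i).2,
    fun _ => hR.1 _, fun _ => hS.1 _, by simp [h]⟩⟩
  · rw [h]
    exact (hR.1 _).kronecker (hS.1 _)
  · simp_rw [h]
    rw [Equiv.sum_comp e fun x => R x.1 ⊗ₖ S x.2, ← one_kronecker_one, ← hR.2, ← hS.2]
    ext u v
    simp [kroneckerMap_apply, Matrix.sum_apply, Fintype.sum_prod_type, Finset.sum_mul_sum]

/-! ### Kraus roots of POVMs and the chain of classes -/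

open scoped MatrixOrder in
theorem exists_conjTranspose_mul_self_eq {n : Type} [Fintype n] {M : Matrix n n ℂ}
    (hM : M.PosSemidef) : ∃ K : Matrix n n ℂ, Kᴴ * K = M := by
  classical
  obtain ⟨K, hK⟩ := CStarAlgebra.nonneg_iff_eq_star_mul_self (A := Matrix n n ℂ).1 hM.nonneg
  exact ⟨K, hK.symm⟩

theorem IsPOVM.exists_kraus {n ι : Type} [Fintype n] [DecidableEq n] [Fintype ι]
    {M : ι → Matrix n n ℂ} (hM : IsPOVM M) :
    ∃ K : ι → Matrix n n ℂ, (∀ i, (K i)ᴴ * K i = M i) ∧ ∑ i, ∑ _y : Unit, (K i)ᴴ * K i = 1 := by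
  choose K hK using fun i => exists_conjTranspose_mul_self_eq (hM.1 i)
  refine ⟨K, hK, ?_⟩
  simp only [Finset.univ_unique, Finset.sum_const, Finset.card_singleton, one_smul]
  rw [← hM.2]
  exact Finset.sum_congr rfl fun i _ => hK i

/-- Each POVM element `R k` factors as `Kᴴ * K`, which makes Alice's measurement a
one-Kraus-operator instrument. Bob does the same in branch `k`, the protocol halts, and `f` relabels
the transcript. -/
theorem IsOneLOCC.isLOCC {A B ι : Type} [Fintype A] [DecidableEq A] [Fintype B] [DecidableEq B]
    [DecidableEq ι] {M : ι → Matrix (A × B) (A × B) ℂ} (hM : IsOneLOCC M) : IsLOCC M := by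
  obtain ⟨r, s, R, S, f, hR, hS, h⟩ := hM
  obtain ⟨K, hK, hK1⟩ := hR.exists_kraus
  choose T hT hT1 using fun k => (hS k).exists_kraus
  have key := IsLOCC.postprocess _ (IsLOCC.alice (B := B) (Y := fun _ => Unit) (fun k _ => K k) hK1
    _ fun k => IsLOCC.bob (A := A) (Y := fun _ => Unit) (fun l _ => T k l) (hT1 k) _
      fun l => IsLOCC.halt) (fun i => f i.1 i.2.1)
  convert key using 2 with i
  rw [h i, Fintype.sum_sigma]
  refine Finset.sum_congr rfl fun k _ => ?_
  rw [Fintype.sum_sigma]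
  refine Finset.sum_congr rfl fun l _ => ?_
  simp only [Finset.univ_unique, Finset.sum_const, Finset.card_singleton, one_smul, mul_one]
  refine if_congr Iff.rfl ?_ rfl
  rw [conjTranspose_kronecker, conjTranspose_kronecker, ← mul_kronecker_mul, ← mul_kronecker_mul,
    ← mul_kronecker_mul, hT]
  simp [hK]

theorem MeasClass.mem_of_isLO {A B : Type} [Fintype A] [DecidableEq A] [Fintype B]
    [DecidableEq B] {k : ℕ} {M : Fin k → Matrix (A × B) (A × B) ℂ} (hM : IsLO M) :
    ∀ C : MeasClass, C.Mem M
  | .LO => hM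
  | .oneLOCC => hM.isOneLOCC
  | .LOCC => hM.isOneLOCC.isLOCC
  | .SEP => hM.isSEP
  | .PPT => hM.isSEP.isPPT

theorem MeasClass.Mem.isPPT {A B : Type} [Fintype A] [DecidableEq A] [Fintype B]
    [DecidableEq B] {k : ℕ} {M : Fin k → Matrix (A × B) (A × B) ℂ} :
    ∀ {C : MeasClass}, C.Mem M → IsPPT M
  | .LO, hM => IsSEP.isPPT (IsLO.isSEP hM)
  | .oneLOCC, hM => IsLOCC.isPPT (IsOneLOCC.isLOCC hM)
  | .LOCC, hM => IsLOCC.isPPT hM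
  | .SEP, hM => IsSEP.isPPT hM
  | .PPT, hM => hM

/-! ### Measured relative entropy of a pure state with respect to its pinching -/

section Pinching

variable {E ι K : Type*} [NormedAddCommGroup E] [InnerProductSpace ℂ E] [Fintype ι]

local notation "⟪" x ", " y "⟫" => inner ℂ x y

/-- Kadison's inequality `X² ≤ ∑ c_i² M_i` for `X = ∑ c_i M_i`. -/
theorem norm_sq_sum_smul_le {M : ι → E →ₗ[ℂ] E} (hM : ∀ i, (M i).IsPositive)
    (hM1 : ∑ i, M i = LinearMap.id) (c : ι → ℝ) (x : E) :
    ‖∑ i, (c i : ℂ) • M i x‖ ^ 2 ≤ ∑ i, c i ^ 2 * (⟪M i x, x⟫).re := by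
  set y := ∑ i, (c i : ℂ) • M i x with hy
  have hyy : ‖y‖ ^ 2 = ∑ i, c i * (⟪M i x, y⟫).re := by
    rw [← inner_self_eq_norm_sq (𝕜 := ℂ)]
    conv_lhs => rw [hy, ← hy, sum_inner]
    simp
  have hsum : ∑ i, (⟪M i y, y⟫).re = ‖y‖ ^ 2 := by
    rw [← inner_self_eq_norm_sq (𝕜 := ℂ)]
    conv_rhs => rw [← LinearMap.id_apply (R := ℂ) y, ← hM1, LinearMap.sum_apply, sum_inner]
    simp [← LinearMap.sum_apply, hM1]
  -- This is positivity of `M i` at the vector `y - c i • x`; the sum over `i` reads `2 ‖y‖² ≤ ‖y‖²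
  -- + ∑ c_i² ⟨M_i x, x⟩`.
  have h : ∀ i, 2 * (c i * (⟪M i x, y⟫).re) ≤ (⟪M i y, y⟫).re + c i ^ 2 * (⟪M i x, x⟫).re := by
    intro i
    have h0 := (hM i).2 (y - (c i : ℂ) • x)
    have hs : (⟪M i y, x⟫).re = (⟪M i x, y⟫).re := by
      rw [(hM i).1 y x, ← inner_conj_symm, Complex.conj_re]
    simp only [map_sub, map_smul, inner_sub_left, inner_sub_right, inner_smul_left,
      inner_smul_right, Complex.conj_ofReal] at h0
    simp only [RCLike.re_to_complex, Complex.sub_re, Complex.re_ofReal_mul,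
      hs] at h0
    linarith
  have := Finset.sum_le_sum fun i (_ : i ∈ Finset.univ) => h i
  rw [← Finset.mul_sum, Finset.sum_add_distrib, hsum, ← hyy] at this
  linarith

variable [Fintype K] [DecidableEq K]

/-- Linearized form of the resolvent comparison. With `w = ∑ c_i M_i ψ`, the left side is twice the
sum of the numbers `u_k = Re ⟨v_k, w⟩`, and `2 u ≤ λ / (λ + t) + u² + t u² / λ`. Kadison's
inequality at `v_k` bounds `u_k²`; Bessel's inequality followed by Kadison's at `ψ` bounds `∑ u_k² /
λ_k`. -/
theorem two_mul_sum_mul_le {M : ι → E →ₗ[ℂ] E} (hM : ∀ i, (M i).IsPositive)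
    (hM1 : ∑ i, M i = LinearMap.id) {v : K → E} {lam : K → ℝ} (hlam : ∀ k, 0 < lam k)
    (hv : ∀ k l, ⟪v k, v l⟫ = if k = l then (lam k : ℂ) else 0) (hv1 : ‖∑ k, v k‖ = 1)
    (c : ι → ℝ) {t : ℝ} (ht : 0 < t) :
    2 * ∑ i, c i * (⟪M i (∑ k, v k), ∑ k, v k⟫).re ≤
      ∑ k, lam k / (lam k + t) + (∑ i, c i ^ 2 * ∑ k, (⟪M i (v k), v k⟫).re +
        t * ∑ i, c i ^ 2 * (⟪M i (∑ k, v k), ∑ k, v k⟫).re) := by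
  set ψ := ∑ k, v k with hψ
  set w := ∑ i, (c i : ℂ) • M i ψ with hw
  have hu : ∀ k, (⟪v k, w⟫).re ^ 2 ≤ ∑ i, c i ^ 2 * (⟪M i (v k), v k⟫).re := by
    intro k
    refine le_trans ?_ (norm_sq_sum_smul_le hM hM1 c (v k))
    have h1 : ⟪v k, w⟫ = ⟪∑ i, (c i : ℂ) • M i (v k), ψ⟫ := by
      rw [hw, inner_sum, sum_inner]
      refine Finset.sum_congr rfl fun i _ => ?_
      rw [inner_smul_left, inner_smul_right, Complex.conj_ofReal, (hM i).1 (v k) ψ]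
    have h2 : |(⟪v k, w⟫).re| ≤ ‖∑ i, (c i : ℂ) • M i (v k)‖ := by
      rw [h1]
      refine (Complex.abs_re_le_norm _).trans ((norm_inner_le_norm _ _).trans ?_)
      rw [hv1, mul_one]
    rw [← sq_abs]
    exact pow_le_pow_left₀ (abs_nonneg _) h2 2
  have hbessel : ∑ k, (⟪v k, w⟫).re ^ 2 / lam k ≤ ‖w‖ ^ 2 := by
    -- Only real parts of the coefficients are kept. Then `‖x‖² = Re ⟨x, w⟩` is the sum to be
    -- bounded, and `‖x - w‖² ≥ 0` finishes.
    set x := ∑ k, (((⟪v k, w⟫).re / lam k : ℝ) : ℂ) • v k with hx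
    have h1 : (⟪x, w⟫).re = ∑ k, (⟪v k, w⟫).re ^ 2 / lam k := by
      rw [hx, sum_inner, Complex.re_sum]
      refine Finset.sum_congr rfl fun k _ => ?_
      rw [inner_smul_left, Complex.conj_ofReal, Complex.re_ofReal_mul]
      ring
    have h2 : (⟪x, x⟫).re = ∑ k, (⟪v k, w⟫).re ^ 2 / lam k := by
      have h3 : ∀ k, ⟪v k, x⟫ = (((⟪v k, w⟫).re : ℝ) : ℂ) := by
        intro k
        rw [hx, inner_sum]
        simp only [inner_smul_right, hv, mul_ite, mul_zero, Finset.sum_ite_eq, Finset.mem_univ,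
          if_true]
        rw [← Complex.ofReal_mul, div_mul_cancel₀ _ (hlam k).ne']
      conv_lhs => rw [hx, ← hx, sum_inner, Complex.re_sum]
      refine Finset.sum_congr rfl fun k _ => ?_
      rw [inner_smul_left, Complex.conj_ofReal, Complex.re_ofReal_mul, h3, Complex.ofReal_re]
      ring
    have h4 := norm_sub_sq (𝕜 := ℂ) x w
    have h5 := inner_self_eq_norm_sq (𝕜 := ℂ) x
    simp only [RCLike.re_to_complex] at h4 h5
    nlinarith [sq_nonneg ‖x - w‖]
  have hsum : ∑ k, (⟪v k, w⟫).re = ∑ i, c i * (⟪M i ψ, ψ⟫).re := by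
    rw [← Complex.re_sum, ← sum_inner, ← hψ, hw, inner_sum, Complex.re_sum]
    refine Finset.sum_congr rfl fun i _ => ?_
    rw [inner_smul_right, Complex.re_ofReal_mul, (hM i).1 ψ ψ]
  have hk : ∀ k, 2 * (⟪v k, w⟫).re ≤ lam k / (lam k + t) +
      ((⟪v k, w⟫).re ^ 2 + t * ((⟪v k, w⟫).re ^ 2 / lam k)) := by
    intro k
    generalize (⟪v k, w⟫).re = u
    have h1 := hlam k
    have h2 : 0 < lam k + t := by positivity
    have : lam k / (lam k + t) + (u ^ 2 + t * (u ^ 2 / lam k)) - 2 * u =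
        (lam k - u * (lam k + t)) ^ 2 / (lam k * (lam k + t)) := by
      field_simp
      ring
    have h3 : 0 ≤ (lam k - u * (lam k + t)) ^ 2 / (lam k * (lam k + t)) := by positivity
    linarith
  have h1 := Finset.sum_le_sum fun k (_ : k ∈ Finset.univ) => hk k
  rw [← Finset.mul_sum, Finset.sum_add_distrib, Finset.sum_add_distrib, ← Finset.mul_sum,
    hsum] at h1
  have h2 := Finset.sum_le_sum fun k (_ : k ∈ Finset.univ) => hu k
  rw [Finset.sum_comm] at h2
  simp_rw [← Finset.mul_sum] at h2
  have h3 := mul_le_mul_of_nonneg_left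
    (hbessel.trans (norm_sq_sum_smul_le hM hM1 c ψ)) ht.le
  linarith

end Pinching

/-- Comparison of logarithmic sums from a comparison of resolvent sums. -/
theorem sum_mul_log_div_le_of_resolvent {ι K : Type*} [Fintype ι] [Fintype K] {p q : ι → ℝ}
    {lam : K → ℝ} (hp : ∀ i, 0 ≤ p i) (hq : ∀ i, 0 ≤ q i) (hpq : ∀ i, q i = 0 → p i = 0)
    (hp1 : ∑ i, p i = 1) (hlam : ∀ k, 0 < lam k) (hlam1 : ∑ k, lam k = 1)
    (h : ∀ t : ℝ, 0 < t → ∑ i, p i ^ 2 / (q i + t * p i) ≤ ∑ k, lam k / (lam k + t)) :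
    ∑ i, p i * Real.log (p i / q i) ≤ -∑ k, lam k * Real.log (lam k) := by
  -- `G 0` is the right side minus the left side of the claim. The hypothesis says `G' ≤ 0`, and `G
  -- T ≥ -1 / T` for large `T`, so `G 0 ≥ 0`. Terms with `p i = 0` have a meaningless quotient `q i
  -- / p i` but carry the factor `p i`.
  set G : ℝ → ℝ := fun t =>
    ∑ i, p i * Real.log (q i / p i + t) - ∑ k, lam k * Real.log (lam k + t) with hG
  have hr : ∀ i, 0 ≤ q i / p i := fun i => div_nonneg (hq i) (hp i)
  have hr' : ∀ i, p i ≠ 0 → 0 < q i / p i := fun i hi =>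
    div_pos ((hq i).lt_of_ne' fun h0 => hi (hpq i h0)) ((hp i).lt_of_ne' hi)
  have hcont : ContinuousOn G (Set.Ici 0) := by
    refine (continuousOn_finsetSum _ fun i _ => ?_).sub (continuousOn_finsetSum _ fun k _ => ?_)
    · by_cases hi : p i = 0
      · simp only [hi, zero_mul]
        exact continuousOn_const
      · refine continuousOn_const.mul (ContinuousOn.log (by fun_prop) fun t ht => ?_)
        exact (add_pos_of_pos_of_nonneg (hr' i hi) ht).ne'
    · refine continuousOn_const.mul (ContinuousOn.log (by fun_prop) fun t ht => ?_)
      exact (add_pos_of_pos_of_nonneg (hlam k) ht).ne'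
  have hderiv : ∀ t, 0 < t → HasDerivAt G
      (∑ i, p i * (1 / (q i / p i + t)) - ∑ k, lam k * (1 / (lam k + t))) t := by
    intro t ht
    refine (HasDerivAt.fun_sum fun i _ => ?_).sub (HasDerivAt.fun_sum fun k _ => ?_)
    · exact (((hasDerivAt_id t).const_add _).log (add_pos_of_nonneg_of_pos (hr i) ht).ne').const_mul
        _
    · exact (((hasDerivAt_id t).const_add _).log (add_pos (hlam k) ht).ne').const_mul _
  have hanti : AntitoneOn G (Set.Ici 0) := by
    refine antitoneOn_of_deriv_nonpos (convex_Ici 0) hcont (fun t ht => ?_) fun t ht => ?_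
    · rw [interior_Ici] at ht
      exact (hderiv t ht).differentiableAt.differentiableWithinAt
    · rw [interior_Ici] at ht
      rw [(hderiv t ht).deriv, sub_nonpos]
      have ht0 : 0 < t := ht
      convert h t ht with i _ k _
      · by_cases hi : p i = 0
        · simp [hi]
        · have := (hp i).lt_of_ne' hi
          have h3 : 0 < q i + t * p i := add_pos_of_nonneg_of_pos (hq i) (by positivity)
          have : q i / p i + t = (q i + t * p i) / p i := by field_simp
          rw [this]
          field_simp
      · rw [mul_one_div]
  have hlow : ∀ T : ℝ, 0 < T → -(1 / T) ≤ G T := by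
    intro T hT
    have h1 : Real.log T ≤ ∑ i, p i * Real.log (q i / p i + T) := by
      rw [← one_mul (Real.log T), ← hp1, Finset.sum_mul]
      exact Finset.sum_le_sum fun i _ => mul_le_mul_of_nonneg_left
        (Real.log_le_log hT (le_add_of_nonneg_left (hr i))) (hp i)
    have h2 : ∑ k, lam k * Real.log (lam k + T) ≤ Real.log (1 + T) := by
      rw [← one_mul (Real.log (1 + T)), ← hlam1, Finset.sum_mul, hlam1]
      refine Finset.sum_le_sum fun k hk => mul_le_mul_of_nonneg_left
        (Real.log_le_log (add_pos (hlam k) hT) ?_) (hlam k).le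
      have := Finset.single_le_sum (fun k _ => (hlam k).le) hk
      linarith
    have h3 : Real.log (1 + T) - Real.log T ≤ 1 / T := by
      rw [← Real.log_div (by positivity) hT.ne']
      refine (Real.log_le_sub_one_of_pos (by positivity)).trans_eq ?_
      field_simp
      ring
    simp only [hG]
    linarith
  have hG0 : 0 ≤ G 0 := by
    refine le_of_forall_pos_le_add fun ε hε => ?_
    have h1 := hlow (1 / ε) (by positivity)
    have h2 := hanti Set.self_mem_Ici (show (0 : ℝ) ≤ 1 / ε by positivity)
      (show (0 : ℝ) ≤ 1 / ε by positivity)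
    rw [one_div_one_div] at h1
    linarith
  have : ∑ i, p i * Real.log (p i / q i) = -∑ i, p i * Real.log (q i / p i + 0) := by
    rw [← Finset.sum_neg_distrib]
    refine Finset.sum_congr rfl fun i _ => ?_
    rw [add_zero, ← inv_div, Real.log_inv]
    ring
  rw [this]
  simp only [hG, add_zero] at hG0 ⊢
  linarith

/-! ### Outcome distributions and the pinching bound -/

theorem outcomeDist_vecMulVec {n ι : Type} [Fintype n] (M : ι → Matrix n n ℂ) (x : n → ℂ) (i : ι) :
    outcomeDist M (vecMulVec x (star x)) i = (star x ⬝ᵥ M i *ᵥ x).re := by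
  rw [outcomeDist, vecMulVec_mul, trace_vecMulVec, dotProduct_comm, dotProduct_mulVec]

theorem outcomeDist_sum {n ι κ : Type} [Fintype n] (M : ι → Matrix n n ℂ) (s : Finset κ)
    (ω : κ → Matrix n n ℂ) (i : ι) :
    outcomeDist M (∑ k ∈ s, ω k) i = ∑ k ∈ s, outcomeDist M (ω k) i := by
  simp [outcomeDist, Finset.sum_mul, trace_sum]

theorem sum_outcomeDist {n ι : Type} [Fintype n] [DecidableEq n] [Fintype ι]
    {M : ι → Matrix n n ℂ} (hM : IsPOVM M) (ω : Matrix n n ℂ) :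
    ∑ i, outcomeDist M ω i = ω.trace.re := by
  simp only [outcomeDist]
  rw [← Complex.re_sum, ← trace_sum, ← Finset.mul_sum, hM.2, mul_one]

/-- Measuring the pure state `∑ v_k`, with the `v_k` orthogonal, the relative entropy with respect
to the pinched state `∑ |v_k⟩⟨v_k|` is at most the entropy of the weights `‖v_k‖²`. -/
theorem relEntropy_pureState_pinching_le {n ι K : Type} [Fintype n] [DecidableEq n] [Fintype ι]
    [Fintype K] [DecidableEq K] {M : ι → Matrix n n ℂ} (hM : IsPOVM M) {v : K → n → ℂ}
    {lam : K → ℝ} (hlam : ∀ k, 0 < lam k) (hlam1 : ∑ k, lam k = 1)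
    (hv : ∀ k l, star (v k) ⬝ᵥ v l = if k = l then (lam k : ℂ) else 0) :
    relEntropy (outcomeDist M (pureState (∑ k, v k)))
      (outcomeDist M (∑ k, vecMulVec (v k) (star (v k)))) ≤
      ((-∑ k, lam k * Real.logb 2 (lam k) : ℝ) : EReal) := by
  set p := outcomeDist M (pureState (∑ k, v k)) with hp
  set q := outcomeDist M (∑ k, vecMulVec (v k) (star (v k))) with hq
  have hpe : ∀ i, p i = (star (∑ k, v k) ⬝ᵥ M i *ᵥ (∑ k, v k)).re := fun i =>
    outcomeDist_vecMulVec _ _ _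
  have hqe : ∀ i, q i = ∑ k, (star (v k) ⬝ᵥ M i *ᵥ v k).re := fun i => by
    rw [hq, outcomeDist_sum]
    exact Finset.sum_congr rfl fun k _ => outcomeDist_vecMulVec _ _ _
  have hp0 : ∀ i, 0 ≤ p i := fun i => by
    rw [hpe]
    exact (hM.1 i).re_dotProduct_nonneg _
  have hq0 : ∀ i, 0 ≤ q i := fun i => by
    rw [hqe]
    exact Finset.sum_nonneg fun k _ => (hM.1 i).re_dotProduct_nonneg _
  have hnorm : star (∑ k, v k) ⬝ᵥ (∑ k, v k) = 1 := by
    rw [star_sum, sum_dotProduct]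
    simp_rw [dotProduct_sum, hv]
    simp only [Finset.sum_ite_eq, Finset.mem_univ, if_true]
    rw [← Complex.ofReal_sum, hlam1, Complex.ofReal_one]
  have hp1 : ∑ i, p i = 1 := by
    rw [hp, sum_outcomeDist hM, pureState, trace_vecMulVec, dotProduct_comm, hnorm,
      Complex.one_re]
  have hsupp : ∀ i, q i = 0 → p i = 0 := by
    intro i hi
    have hk0 : ∀ k, 0 ≤ (star (v k) ⬝ᵥ M i *ᵥ v k).re := fun k =>
      (hM.1 i).re_dotProduct_nonneg _
    rw [hqe, Finset.sum_eq_zero_iff_of_nonneg fun k _ => hk0 k] at hi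
    have h0 : ∀ k, M i *ᵥ v k = 0 := fun k => by
      rw [← (hM.1 i).dotProduct_mulVec_zero_iff]
      have h1 := (hM.1 i).dotProduct_mulVec_nonneg (v k)
      exact Complex.ext (hi k (Finset.mem_univ _)) (Complex.nonneg_iff.1 h1).2.symm
    rw [hpe, mulVec_sum]
    simp [h0]
  rw [relEntropy, if_pos hsupp, EReal.coe_le_coe_iff]
  let V : K → EuclideanSpace ℂ n := fun k => WithLp.toLp 2 (v k)
  have hpos : ∀ i, (toEuclideanLin (M i)).IsPositive := fun i =>
    isPositive_toEuclideanLin_iff.2 (hM.1 i)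
  have hsum1 : ∑ i, toEuclideanLin (M i) = LinearMap.id := by
    rw [← map_sum, hM.2]
    exact toLpLin_one 2
  have hinner : ∀ x y : n → ℂ, inner ℂ (WithLp.toLp 2 x : EuclideanSpace ℂ n) (WithLp.toLp 2 y) =
      star x ⬝ᵥ y := fun x y => by
    rw [EuclideanSpace.inner_eq_star_dotProduct, dotProduct_comm]
  have hre : ∀ i (x : n → ℂ), (inner ℂ (toEuclideanLin (M i) (WithLp.toLp 2 x))
      (WithLp.toLp 2 x : EuclideanSpace ℂ n)).re = (star x ⬝ᵥ M i *ᵥ x).re := fun i x => by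
    rw [(hpos i).1, toLpLin_toLp, hinner, toLin'_apply]
  have hVsum : ∑ k, V k = WithLp.toLp 2 (∑ k, v k) := (WithLp.toLp_sum 2 _ Finset.univ v).symm
  have hV1 : ‖∑ k, V k‖ = 1 := by
    rw [← sq_eq_sq₀ (norm_nonneg _) zero_le_one, ← inner_self_eq_norm_sq (𝕜 := ℂ), hVsum, hinner,
      hnorm]
    simp
  have key := sum_mul_log_div_le_of_resolvent hp0 hq0 hsupp hp1 hlam hlam1 fun t ht => by
    -- This choice of `c` maximizes `2 c p - c² (q + t p)` for each outcome, with maximum `p² / (q +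
    -- t p)`.
    have h1 := two_mul_sum_mul_le hpos hsum1 hlam (v := V)
      (fun k l => (hinner _ _).trans (hv k l)) hV1 (fun i => p i / (q i + t * p i)) ht
    simp only [hVsum, V, hre, ← hpe, ← hqe] at h1
    have h2 : ∀ i, p i / (q i + t * p i) * p i = p i ^ 2 / (q i + t * p i) := fun i => by ring
    have h3 : ∑ i, (p i / (q i + t * p i)) ^ 2 * q i + t * ∑ i, (p i / (q i + t * p i)) ^ 2 * p i =
        ∑ i, p i ^ 2 / (q i + t * p i) := by
      rw [Finset.mul_sum, ← Finset.sum_add_distrib]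
      refine Finset.sum_congr rfl fun i _ => ?_
      by_cases hi : p i = 0
      · simp [hi]
      · have : 0 < q i + t * p i :=
          add_pos_of_nonneg_of_pos (hq0 i) (mul_pos ht ((hp0 i).lt_of_ne' hi))
        field_simp
    simp only [h2, h3] at h1
    linarith
  have hl : 0 < Real.log 2 := Real.log_pos one_lt_two
  have e1 : ∑ i, p i * Real.logb 2 (p i / q i) =
      (∑ i, p i * Real.log (p i / q i)) / Real.log 2 := by
    simp only [Real.logb, Finset.sum_div, mul_div_assoc]
  have e2 : -∑ k, lam k * Real.logb 2 (lam k) =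
      (-∑ k, lam k * Real.log (lam k)) / Real.log 2 := by
    simp only [Real.logb, Finset.sum_div, mul_div_assoc, neg_div]
  rw [e1, e2]
  exact div_le_div_of_nonneg_right key hl.le

/-! ### Product vectors and separable states -/

/-- The product vector `a ⊗ b`. -/
def prodVec {A B : Type} (a : A → ℂ) (b : B → ℂ) : A × B → ℂ := fun x => a x.1 * b x.2

theorem star_prodVec_dotProduct {A B : Type} [Fintype A] [Fintype B] (a a' : A → ℂ)
    (b b' : B → ℂ) :
    star (prodVec a b) ⬝ᵥ prodVec a' b' = (star a ⬝ᵥ a') * (star b ⬝ᵥ b') := by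
  simp only [dotProduct, prodVec, Pi.star_apply, star_mul', Finset.sum_mul_sum,
    Fintype.sum_prod_type]
  exact Finset.sum_congr rfl fun _ _ => Finset.sum_congr rfl fun _ _ => by ring

theorem vecMulVec_prodVec {A B : Type} (a : A → ℂ) (b : B → ℂ) :
    vecMulVec (prodVec a b) (star (prodVec a b)) =
      vecMulVec a (star a) ⊗ₖ vecMulVec b (star b) := by
  ext x y
  simp only [prodVec, vecMulVec_apply, kroneckerMap_apply, Pi.star_apply, star_mul']
  ring

theorem isDensity_vecMulVec {n : Type} [Fintype n] {a : n → ℂ} (h : star a ⬝ᵥ a = 1) :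
    IsDensity (vecMulVec a (star a)) :=
  ⟨posSemidef_vecMulVec_self_star a, by rw [trace_vecMulVec, dotProduct_comm, h]⟩

theorem isSeparableState_sum {A B K : Type} [Fintype A] [Fintype B] [Fintype K] {p : K → ℝ}
    {α : K → Matrix A A ℂ} {β : K → Matrix B B ℂ} (hp : ∀ k, 0 ≤ p k) (hp1 : ∑ k, p k = 1)
    (hα : ∀ k, IsDensity (α k)) (hβ : ∀ k, IsDensity (β k)) :
    IsSeparableState (∑ k, (p k : ℂ) • (α k ⊗ₖ β k)) := by
  let e := (Fintype.equivFin K).symm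
  refine ⟨Fintype.card K, p ∘ e, α ∘ e, β ∘ e, fun j => hp _, ?_, fun j => hα _, fun j => hβ _, ?_⟩
  · rw [← hp1]
    exact Equiv.sum_comp e p
  · exact (Equiv.sum_comp e fun k => (p k : ℂ) • (α k ⊗ₖ β k)).symm

/-- A single separable state tested against all PPT measurements bounds the quantity for all five
classes at once. -/
theorem measuredREE_le {A B : Type} [Fintype A] [DecidableEq A] [Fintype B] [DecidableEq B]
    (C : MeasClass) {ρ σ : Matrix (A × B) (A × B) ℂ} (hσ : IsSeparableState σ) {x : EReal}
    (h : ∀ (k : ℕ) (M : Fin k → Matrix (A × B) (A × B) ℂ), IsPPT M →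
      relEntropy (outcomeDist M ρ) (outcomeDist M σ) ≤ x) : measuredREE C ρ ≤ x :=
  iInf₂_le_of_le σ hσ (iSup_le fun k => iSup₂_le fun M hM => h k M hM.isPPT)

/-- A Schmidt decomposition `ψ = ∑ √λ_k a_k ⊗ b_k`. -/
structure IsSchmidt {A B K : Type} [Fintype A] [Fintype B] [Fintype K] [DecidableEq K]
    (lam : K → ℝ) (ψ : A × B → ℂ) (a : K → A → ℂ) (b : K → B → ℂ) : Prop where
  left : ∀ i j, star (a i) ⬝ᵥ a j = if i = j then 1 else 0
  right : ∀ i j, star (b i) ⬝ᵥ b j = if i = j then 1 else 0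
  eq : ∀ x, ψ x = ∑ k, ((√(lam k) : ℝ) : ℂ) * (a k x.1 * b k x.2)

/-- The separable state is `∑ λ_k |a_k b_k⟩⟨a_k b_k|`, the pinching of `ψ` in its Schmidt basis. The
bound holds for arbitrary POVMs; positivity of partial transposes plays no part. -/
theorem IsSchmidt.measuredREE_le {A B K : Type} [Fintype A] [DecidableEq A] [Fintype B]
    [DecidableEq B] [Fintype K] [DecidableEq K] {lam : K → ℝ} {ψ : A × B → ℂ} {a : K → A → ℂ}
    {b : K → B → ℂ} (h : IsSchmidt lam ψ a b) (hlam : ∀ k, 0 < lam k) (hlam1 : ∑ k, lam k = 1)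
    (C : MeasClass) :
    measuredREE C (pureState ψ) ≤ ((-∑ k, lam k * Real.logb 2 (lam k) : ℝ) : EReal) := by
  set v : K → A × B → ℂ := fun k => ((√(lam k) : ℝ) : ℂ) • prodVec (a k) (b k) with hv
  have hs : ∀ k, ((√(lam k) : ℝ) : ℂ) * ((√(lam k) : ℝ) : ℂ) = (lam k : ℂ) := fun k => by
    rw [← Complex.ofReal_mul, Real.mul_self_sqrt (hlam k).le]
  have hψ : ψ = ∑ k, v k := by
    ext x
    rw [h.eq, Finset.sum_apply]
    rfl
  have hvv : ∀ k l, star (v k) ⬝ᵥ v l = if k = l then (lam k : ℂ) else 0 := by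
    intro k l
    simp only [hv, star_smul, smul_dotProduct, dotProduct_smul, star_prodVec_dotProduct, h.left,
      h.right]
    split_ifs with hkl
    · subst hkl
      simp [hs]
    · simp
  have hproj : ∀ k, vecMulVec (v k) (star (v k)) =
      (lam k : ℂ) • (vecMulVec (a k) (star (a k)) ⊗ₖ vecMulVec (b k) (star (b k))) := by
    intro k
    rw [← vecMulVec_prodVec, ← hs k]
    simp only [hv, star_smul, smul_vecMulVec, vecMulVec_smul, smul_smul]
    simp
  refine _root_.measuredREE_le C (isSeparableState_sum (fun k => (hlam k).le) hlam1
    (fun k => isDensity_vecMulVec ((h.left k k).trans (if_pos rfl)))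
    (fun k => isDensity_vecMulVec ((h.right k k).trans (if_pos rfl)))) fun m M hM => ?_
  simp_rw [← hproj, hψ]
  exact relEntropy_pureState_pinching_le hM.1 hlam hlam1 hvv

/-! ### The separable isotropic state -/

/-- The isotropic state `(1 + d Φ_d) / (d (d + 1))`. -/
def isotropicState (d : ℕ) : Matrix (Fin d × Fin d) (Fin d × Fin d) ℂ :=
  of fun x y => ((1 / (d * (d + 1)) : ℝ) : ℂ) *
    ((if x = y then 1 else 0) + if x.1 = x.2 ∧ y.1 = y.2 then 1 else 0)

/-- A character of the group `(ZMod 3)^d` sums to zero unless it is trivial. Cube roots of unity are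
used because with signs the extra pairing `a = b'`, `a' = b` would survive as well. -/
theorem sum_stdAddChar_eq {d : ℕ} (a b a' b' : Fin d) :
    ∑ k : Fin d → ZMod 3, ZMod.stdAddChar (k a + k b' - k a' - k b) =
      if (a = a' ∧ b = b') ∨ (a = b ∧ a' = b') then (3 : ℂ) ^ d else 0 := by
  split_ifs with h
  · have h0 : ∀ k : Fin d → ZMod 3, k a + k b' - k a' - k b = 0 := by
      rcases h with ⟨rfl, rfl⟩ | ⟨rfl, rfl⟩ <;> intro k <;> ring
    simp [h0, ZMod.card]
  · set S := ∑ k : Fin d → ZMod 3, (ZMod.stdAddChar (k a + k b' - k a' - k b) : ℂ) with hS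
    have hshift : ∀ m : Fin d → ZMod 3,
        S = ZMod.stdAddChar (m a + m b' - m a' - m b) * S := by
      intro m
      rw [hS, Finset.mul_sum, ← Equiv.sum_comp (Equiv.addLeft m)]
      refine Finset.sum_congr rfl fun k _ => ?_
      rw [← AddChar.map_add_eq_mul]
      congr 1
      simp only [Equiv.coe_addLeft, Pi.add_apply]
      ring
    have hm : ∃ m : Fin d → ZMod 3, m a + m b' - m a' - m b ≠ 0 := by
      by_cases h1 : a = a'
      · subst h1
        refine ⟨Pi.single b 1, ?_⟩
        have : b ≠ b' := fun hb => h (Or.inl ⟨rfl, hb⟩)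
        simp [Pi.single_apply, this.symm]
      · by_cases h2 : a = b
        · subst h2
          refine ⟨Pi.single a' 1, ?_⟩
          have : b' ≠ a' := fun hb => h (Or.inr ⟨rfl, hb.symm⟩)
          simp [this, h1]
        · refine ⟨Pi.single a 1, ?_⟩
          by_cases h3 : b' = a
          -- In this case the exponent is `1 + 1`, nonzero modulo `3` but not modulo `2`.
          · simp [Ne.symm h1, Ne.symm h2, h3]
            decide
          · simp [Ne.symm h1, Ne.symm h2, h3]
    obtain ⟨m, hm⟩ := hm
    have h1 := hshift m
    by_contra hS0
    have h2 : (ZMod.stdAddChar (m a + m b' - m a' - m b) : ℂ) = 1 := by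
      have h3 : (ZMod.stdAddChar (m a + m b' - m a' - m b) - 1) * S = 0 := by
        rw [sub_mul, one_mul, ← h1, sub_self]
      exact sub_eq_zero.1 ((mul_eq_zero.1 h3).resolve_right hS0)
    rw [← AddChar.map_zero_eq_one (ZMod.stdAddChar (N := 3))] at h2
    exact hm (ZMod.injective_stdAddChar h2)

/-- Averaging `|u⟩⟨u| ⊗ |ū⟩⟨ū|` over vectors `u` with independent random phases produces the
identity plus `d Φ_d`, except that entries with all four indices equal are counted once instead of
twice. The product basis states `|i i⟩` supply the missing part. -/
theorem isSeparableState_isotropicState {d : ℕ} (hd : 0 < d) :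
    IsSeparableState (isotropicState d) := by
  have hd0 : (0 : ℝ) < d := Nat.cast_pos.2 hd
  have hdC : (d : ℂ) ≠ 0 := Nat.cast_ne_zero.2 hd.ne'
  let u : (Fin d → ZMod 3) → Fin d → ℂ := fun k a =>
    ((1 / √d : ℝ) : ℂ) * ZMod.stdAddChar (k a)
  have hsq : ((1 / √d : ℝ) : ℂ) * ((1 / √d : ℝ) : ℂ) = 1 / d := by
    rw [← Complex.ofReal_mul, div_mul_div_comm, one_mul, Real.mul_self_sqrt hd0.le]
    simp
  have hu : ∀ k a a', u k a * star (u k a') = 1 / d * ZMod.stdAddChar (k a - k a') := by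
    intro k a a'
    have : star (ZMod.stdAddChar (k a') : ℂ) = ZMod.stdAddChar (-k a') :=
      (AddChar.map_neg_eq_conj _ _).symm
    simp only [u, star_mul', this]
    rw [sub_eq_add_neg, AddChar.map_add_eq_mul, ← hsq]
    simp only [Complex.star_def, Complex.conj_ofReal]
    ring
  have hu1 : ∀ k, star (u k) ⬝ᵥ u k = 1 := by
    intro k
    rw [dotProduct_comm, dotProduct]
    simp only [Pi.star_apply, hu, sub_self, AddChar.map_zero_eq_one]
    simp [hdC]
  -- The phase vectors have total weight `d / (d + 1)`, the basis states `1 / (d + 1)`.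
  let p : (Fin d → ZMod 3) ⊕ Fin d → ℝ :=
    Sum.elim (fun _ => d / (d + 1) / 3 ^ d) fun _ => 1 / (d * (d + 1))
  let x : (Fin d → ZMod 3) ⊕ Fin d → Fin d → ℂ := Sum.elim u fun i => Pi.single i 1
  have hx : ∀ k, star (x k) ⬝ᵥ x k = 1 := by
    rintro (k | i)
    · exact hu1 k
    · simp [x]
  have hx' : ∀ k, star (star (x k)) ⬝ᵥ star (x k) = 1 := fun k => by
    rw [star_star, dotProduct_comm, hx]
  have key := isSeparableState_sum (p := p) (fun k => ?_) ?_ (fun k => isDensity_vecMulVec (hx k))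
    fun k => isDensity_vecMulVec (hx' k)
  · convert key using 1
    ext ⟨a, b⟩ ⟨a', b'⟩
    rw [Matrix.sum_apply, Fintype.sum_sum_type]
    have e1 : ∀ k : Fin d → ZMod 3, ((p (Sum.inl k) : ℂ) •
        (vecMulVec (x (Sum.inl k)) (star (x (Sum.inl k))) ⊗ₖ
          vecMulVec (star (x (Sum.inl k))) (star (star (x (Sum.inl k)))))) (a, b) (a', b') =
        ((d / (d + 1) / 3 ^ d : ℝ) : ℂ) * (1 / d * (1 / d)) *
          ZMod.stdAddChar (k a + k b' - k a' - k b) := by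
      intro k
      simp only [p, x, Sum.elim_inl, Matrix.smul_apply, kroneckerMap_apply, vecMulVec_apply,
        Pi.star_apply, star_star, smul_eq_mul]
      rw [mul_comm (star (u k b)), hu, hu, show k a + k b' - k a' - k b =
        (k a - k a') + (k b' - k b) by ring, AddChar.map_add_eq_mul]
      ring
    have e2 : ∀ i : Fin d, ((p (Sum.inr i) : ℂ) •
        (vecMulVec (x (Sum.inr i)) (star (x (Sum.inr i))) ⊗ₖ
          vecMulVec (star (x (Sum.inr i))) (star (star (x (Sum.inr i)))))) (a, b) (a', b') =
        ((1 / (d * (d + 1)) : ℝ) : ℂ) * if i = a ∧ i = b ∧ i = a' ∧ i = b' then 1 else 0 := by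
      intro i
      simp only [p, x, Sum.elim_inr, Matrix.smul_apply, kroneckerMap_apply, vecMulVec_apply,
        Pi.star_apply, star_star, smul_eq_mul, Pi.single_apply]
      congr 1
      by_cases h1 : a = i <;> by_cases h2 : b = i <;> by_cases h3 : a' = i <;>
        by_cases h4 : b' = i <;> simp [h1, h2, h3, h4, eq_comm]
    simp_rw [e1, e2]
    rw [← Finset.mul_sum, ← Finset.mul_sum, sum_stdAddChar_eq]
    have e3 : (∑ i : Fin d, if i = a ∧ i = b ∧ i = a' ∧ i = b' then (1 : ℂ) else 0) =
        if a = b ∧ a = a' ∧ a = b' then 1 else 0 := by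
      by_cases h : a = b ∧ a = a' ∧ a = b'
      · obtain ⟨rfl, rfl, rfl⟩ := h
        simp
      · rw [if_neg h]
        refine Finset.sum_eq_zero fun i _ => if_neg ?_
        rintro ⟨rfl, h⟩
        exact absurd h (by tauto)
    rw [e3]
    simp only [isotropicState, of_apply, Prod.mk.injEq]
    have e4 : ((d / (d + 1) / 3 ^ d : ℝ) : ℂ) * (1 / d * (1 / d)) * 3 ^ d =
        ((1 / (d * (d + 1)) : ℝ) : ℂ) := by
      push_cast
      field_simp
    rw [mul_ite, mul_zero, e4]
    by_cases h1 : a = a' ∧ b = b' <;> by_cases h2 : a = b ∧ a' = b'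
    · obtain ⟨rfl, rfl⟩ := h1
      obtain ⟨rfl, -⟩ := h2
      simp
      ring
    · rw [if_pos h1, if_neg h2, if_pos (Or.inl h1), if_neg (by grind)]
      simp
    · rw [if_neg h1, if_pos h2, if_pos (Or.inr h2), if_neg (by grind)]
      simp
    · rw [if_neg h1, if_neg h2, if_neg (by tauto), if_neg (by grind)]
      simp
  · rcases k with k | i <;> simp only [p, Sum.elim_inl, Sum.elim_inr] <;> positivity
  · simp only [p, Fintype.sum_sum_type, Sum.elim_inl, Sum.elim_inr, Finset.sum_const,
      Finset.card_univ, Fintype.card_fun, ZMod.card, Fintype.card_fin, nsmul_eq_mul]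
    push_cast
    field_simp

/-! ### PPT elements and the upper bound for the maximally entangled state -/

theorem re_dotProduct_add_le {n : Type} [Fintype n] {M : Matrix n n ℂ} (hM : M.PosSemidef)
    (x y : n → ℂ) :
    (star x ⬝ᵥ M *ᵥ y).re + (star y ⬝ᵥ M *ᵥ x).re ≤
      (star x ⬝ᵥ M *ᵥ x).re + (star y ⬝ᵥ M *ᵥ y).re := by
  have h : 0 ≤ (star (x - y) ⬝ᵥ M *ᵥ (x - y)).re := hM.re_dotProduct_nonneg (x - y)
  simp only [star_sub, mulVec_sub, sub_dotProduct, dotProduct_sub, Complex.sub_re] at h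
  linarith

theorem re_apply_add_le {n : Type} [Fintype n] [DecidableEq n] {M : Matrix n n ℂ}
    (hM : M.PosSemidef) (x y : n) :
    (M x y).re + (M y x).re ≤ (M x x).re + (M y y).re := by
  have h := re_dotProduct_add_le hM (Pi.single x 1) (Pi.single y 1)
  simpa using h

/-- The entry of `M` at `(a, a), (b, b)` is the entry of its partial transpose at `(a, b), (b, a)`.
Testing positivity on `e_ab - e_ba` bounds it by diagonal entries, which the partial transpose does
not change. -/
theorem sum_re_diag_le_of_partialTranspose {d : ℕ} {M : Matrix (Fin d × Fin d) (Fin d × Fin d) ℂ}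
    (hM : (partialTranspose M).PosSemidef) :
    ∑ a, ∑ b, (M (a, a) (b, b)).re ≤ ∑ x, (M x x).re := by
  have h : ∀ a b, (M (a, a) (b, b)).re + (M (b, b) (a, a)).re ≤
      (M (a, b) (a, b)).re + (M (b, a) (b, a)).re := fun a b => by
    have := re_apply_add_le hM (a, b) (b, a)
    simpa [partialTranspose] using this
  have h2 := Finset.sum_le_sum fun a (_ : a ∈ Finset.univ) =>
    Finset.sum_le_sum fun b (_ : b ∈ Finset.univ) => h a b
  simp only [Finset.sum_add_distrib] at h2
  rw [Finset.sum_comm (f := fun a b => (M (b, b) (a, a)).re),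
    Finset.sum_comm (f := fun a b => (M (b, a) (b, a)).re)] at h2
  rw [Fintype.sum_prod_type]
  linarith

theorem relEntropy_le_logb {ι : Type} [Fintype ι] {p q : ι → ℝ} (hp : ∀ i, 0 ≤ p i)
    (hp1 : ∑ i, p i = 1) {c : ℝ} (h : ∀ i, p i ≤ c * q i) (hq : ∀ i, 0 ≤ q i) :
    relEntropy p q ≤ (Real.logb 2 c : EReal) := by
  have h0 : ∀ i, q i = 0 → p i = 0 := fun i hi => (by simpa [hi] using h i : p i ≤ 0).antisymm (hp i)
  rw [relEntropy, if_pos h0, EReal.coe_le_coe_iff, ← one_mul (Real.logb 2 c), ← hp1,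
    Finset.sum_mul]
  refine Finset.sum_le_sum fun i _ => ?_
  rcases (hp i).eq_or_lt with hi | hi
  · simp [← hi]
  · have hqi : 0 < q i := (hq i).lt_of_ne' fun h1 => hi.ne' (h0 i h1)
    exact mul_le_mul_of_nonneg_left (Real.logb_le_logb_of_le one_lt_two (div_pos hi hqi)
      ((div_le_iff₀ hqi).2 (h i))) hi.le

theorem measuredREE_maxEntangled_le {d : ℕ} (hd : 0 < d) (C : MeasClass) :
    measuredREE C (maxEntangled d) ≤ ((Real.logb 2 ((d : ℝ) + 1) - 1 : ℝ) : EReal) := by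
  have hd0 : (0 : ℝ) < d := Nat.cast_pos.2 hd
  have hlog : Real.logb 2 ((d : ℝ) + 1) - 1 = Real.logb 2 ((d + 1) / 2) := by
    rw [Real.logb_div (by positivity) two_ne_zero, Real.logb_self_eq_one one_lt_two]
  rw [hlog]
  refine measuredREE_le C (isSeparableState_isotropicState hd) fun k M hM => ?_
  have hentry : ∀ x y, maxEntangled d x y =
      ((1 / d : ℝ) : ℂ) * if x.1 = x.2 ∧ y.1 = y.2 then 1 else 0 := by
    intro x y
    have hsq : ((1 / √d : ℝ) : ℂ) * ((1 / √d : ℝ) : ℂ) = ((1 / d : ℝ) : ℂ) := by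
      rw [← Complex.ofReal_mul, div_mul_div_comm, one_mul, Real.mul_self_sqrt hd0.le]
    rw [maxEntangled, pureState, vecMulVec_apply, Pi.star_apply, apply_ite star, star_zero,
      Complex.star_def, Complex.conj_ofReal, ite_and, ← hsq]
    split_ifs <;> simp
  have hdiag : ∀ i, (∑ x : Fin d × Fin d, ∑ y : Fin d × Fin d,
      (if x.1 = x.2 ∧ y.1 = y.2 then 1 else 0) * M i y x).re =
      ∑ a, ∑ b, (M i (a, a) (b, b)).re := by
    intro i
    rw [Finset.sum_comm]
    simp only [Fintype.sum_prod_type, ite_and, ite_mul, one_mul, zero_mul, Complex.re_sum]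
    simp [apply_ite Complex.re]
  have hp : ∀ i, outcomeDist M (maxEntangled d) i =
      1 / d * ∑ a, ∑ b, (M i (a, a) (b, b)).re := by
    intro i
    rw [outcomeDist, trace, ← hdiag, ← Complex.re_ofReal_mul, Finset.mul_sum]
    simp only [diag_apply, Matrix.mul_apply, hentry, mul_assoc, Finset.mul_sum]
  have hq : ∀ i, outcomeDist M (isotropicState d) i =
      1 / (d * (d + 1)) * (∑ x, (M i x x).re + ∑ a, ∑ b, (M i (a, a) (b, b)).re) := by
    intro i
    rw [outcomeDist, trace, ← hdiag, ← Complex.re_sum, ← Complex.add_re, ← Complex.re_ofReal_mul,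
      ← Finset.sum_add_distrib, Finset.mul_sum]
    simp only [diag_apply, Matrix.mul_apply, isotropicState, of_apply, mul_assoc, add_mul,
      ← Finset.mul_sum, Finset.sum_add_distrib]
    simp
  have hp0 : ∀ i, 0 ≤ outcomeDist M (maxEntangled d) i := fun i => by
    rw [maxEntangled, pureState, outcomeDist_vecMulVec]
    exact (hM.1.1 i).re_dotProduct_nonneg _
  -- With `T = tr (M d Φ_d) ≤ tr M`, the right side is `(tr M + T) / (2 d)` and the left side is `T
  -- / d`.
  have hle : ∀ i, outcomeDist M (maxEntangled d) i ≤
      (d + 1) / 2 * outcomeDist M (isotropicState d) i := by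
    intro i
    have h1 := sum_re_diag_le_of_partialTranspose (hM.2 i)
    rw [hp, hq]
    have : (d + 1 : ℝ) / 2 * (1 / (d * (d + 1)) *
        (∑ x, (M i x x).re + ∑ a, ∑ b, (M i (a, a) (b, b)).re)) =
        1 / d * ((∑ x, (M i x x).re + ∑ a, ∑ b, (M i (a, a) (b, b)).re) / 2) := by
      field_simp
    rw [this]
    exact mul_le_mul_of_nonneg_left (by linarith) (by positivity)
  refine relEntropy_le_logb hp0 ?_ hle fun i => ?_
  · rw [sum_outcomeDist hM.1, trace]
    simp only [diag_apply, hentry, and_self]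
    rw [← Finset.mul_sum, Complex.re_ofReal_mul, Fintype.sum_prod_type]
    simp [hd0.ne']
  · exact nonneg_of_mul_nonneg_right ((hp0 i).trans (hle i)) (by positivity)

/-! ### Optimal Schmidt decompositions -/

section Mixing

variable {A B K : Type} [DecidableEq K]

theorem sum_eq_sum_of_pair {K R : Type*} [Fintype K] [AddCommGroup R] {f g : K → R} {i j : K} (hij : i ≠ j)
    (h : ∀ k, k ≠ i → k ≠ j → f k = g k) (h2 : f i + f j = g i + g j) :
    ∑ k, f k = ∑ k, g k := by
  classical
  rw [← sub_eq_zero, ← Finset.sum_sub_distrib, Fintype.sum_eq_add i j hij fun k hk =>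
    sub_eq_zero.2 (h k hk.1 hk.2)]
  rw [sub_add_sub_comm, h2, sub_self]

/-- Replace the vectors `a_i, a_j` by `(a_i ± c a_j) / √2`. -/
def mixPair (a : K → A → ℂ) (i j : K) (c : ℂ) : K → A → ℂ := fun k =>
  if k = i then ((1 / √2 : ℝ) : ℂ) • (a i + c • a j)
  else if k = j then ((1 / √2 : ℝ) : ℂ) • (a i - c • a j) else a k

theorem ofReal_inv_sqrt_two_mul_self : ((1 / √2 : ℝ) : ℂ) * ((1 / √2 : ℝ) : ℂ) = 1 / 2 := by
  rw [← Complex.ofReal_mul, div_mul_div_comm, one_mul, Real.mul_self_sqrt zero_le_two]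
  simp

theorem mixPair_left (a : K → A → ℂ) (i j : K) (c : ℂ) :
    mixPair a i j c i = ((1 / √2 : ℝ) : ℂ) • (a i + c • a j) := if_pos rfl

theorem mixPair_right (a : K → A → ℂ) {i j : K} (hij : i ≠ j) (c : ℂ) :
    mixPair a i j c j = ((1 / √2 : ℝ) : ℂ) • (a i - c • a j) := by
  rw [mixPair, if_neg hij.symm, if_pos rfl]

theorem mixPair_of_ne (a : K → A → ℂ) {i j k : K} (hi : k ≠ i) (hj : k ≠ j) (c : ℂ) :
    mixPair a i j c k = a k := by
  rw [mixPair, if_neg hi, if_neg hj]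

theorem star_mixPair_dotProduct [Fintype A] {a : K → A → ℂ}
    (ha : ∀ k l, star (a k) ⬝ᵥ a l = if k = l then 1 else 0) {i j : K} (hij : i ≠ j) {c : ℂ}
    (hc : star c * c = 1) (k l : K) :
    star (mixPair a i j c k) ⬝ᵥ mixPair a i j c l = if k = l then 1 else 0 := by
  have hr : star ((1 / √2 : ℝ) : ℂ) = ((1 / √2 : ℝ) : ℂ) := Complex.conj_ofReal _
  have h2 := ofReal_inv_sqrt_two_mul_self
  generalize hrr : ((1 / √2 : ℝ) : ℂ) = r at hr h2
  have hii : ∀ k, star (a k) ⬝ᵥ a k = 1 := fun k => (ha k k).trans (if_pos rfl)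
  have hne : ∀ k l, k ≠ l → star (a k) ⬝ᵥ a l = 0 := fun k l h => (ha k l).trans (if_neg h)
  have hL := mixPair_left a i j c
  have hR := mixPair_right a hij c
  have hN := fun k (h1 : k ≠ i) (h2 : k ≠ j) => mixPair_of_ne a h1 h2 c
  rw [hrr] at hL hR
  by_cases hki : k = i <;> by_cases hli : l = i
  · subst hki hli
    rw [hL, if_pos rfl]
    simp only [star_smul, star_add, smul_dotProduct, dotProduct_smul, add_dotProduct,
      dotProduct_add, hr, smul_eq_mul, hii, hne _ _ hij, hne _ _ hij.symm]
    linear_combination r * r * hc + 2 * h2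
  · subst hki
    by_cases hlj : l = j
    · subst hlj
      rw [hL, hR, if_neg hij]
      simp only [star_smul, star_add, smul_dotProduct, dotProduct_smul, add_dotProduct,
        dotProduct_sub, hr, smul_eq_mul, hii, hne _ _ hij, hne _ _ hij.symm]
      linear_combination -(r * r) * hc
    · rw [hL, hN l hli hlj, if_neg (Ne.symm hli)]
      simp [star_smul, star_add, smul_dotProduct, add_dotProduct, hne _ _ (Ne.symm hli),
        hne _ _ (Ne.symm hlj)]
  · subst hli
    by_cases hkj : k = j
    · subst hkj
      rw [hL, hR, if_neg hij.symm]
      simp only [star_smul, star_sub, smul_dotProduct, dotProduct_smul, sub_dotProduct,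
        dotProduct_add, hr, smul_eq_mul, hii, hne _ _ hij, hne _ _ hij.symm]
      linear_combination -(r * r) * hc
    · rw [hL, hN k hki hkj, if_neg hki]
      simp [dotProduct_smul, dotProduct_add, hne _ _ hki, hne _ _ hkj]
  · by_cases hkj : k = j <;> by_cases hlj : l = j
    · subst hkj hlj
      rw [hR, if_pos rfl]
      simp only [star_smul, star_sub, smul_dotProduct, dotProduct_smul, sub_dotProduct,
        dotProduct_sub, hr, smul_eq_mul, hii, hne _ _ hij, hne _ _ hij.symm]
      linear_combination r * r * hc + 2 * h2
    · subst hkj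
      rw [hR, hN l hli hlj, if_neg (Ne.symm hlj)]
      simp [star_smul, star_sub, smul_dotProduct, sub_dotProduct, hne _ _ (Ne.symm hli),
        hne _ _ (Ne.symm hlj)]
    · subst hlj
      rw [hR, hN k hki hkj, if_neg hkj]
      simp [dotProduct_smul, dotProduct_sub, hne _ _ hki, hne _ _ hkj]
    · rw [hN k hki hkj, hN l hli hlj, ha]

/-- The phase `c` on Alice's side and its conjugate on Bob's cancel in the diagonal products. Only
the cross terms keep a phase, and they enter the partner vector of `prodVec_mixPair_right` with
opposite sign, so the sum of the two products is unchanged. -/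
theorem prodVec_mixPair_left (a : K → A → ℂ) (b : K → B → ℂ) (i j : K) {c : ℂ}
    (hc : star c * c = 1) :
    prodVec (mixPair a i j c i) (mixPair b i j (star c) i) =
      ((1 / 2 : ℝ) : ℂ) • ((prodVec (a i) (b i) + prodVec (a j) (b j)) +
        (c • prodVec (a j) (b i) + star c • prodVec (a i) (b j))) := by
  have h2 := ofReal_inv_sqrt_two_mul_self
  rw [mixPair_left, mixPair_left]
  generalize ((1 / √2 : ℝ) : ℂ) = r at h2 ⊢
  ext x
  simp only [prodVec, Pi.smul_apply, Pi.add_apply, smul_eq_mul, Complex.ofReal_div,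
    Complex.ofReal_one, Complex.ofReal_ofNat]
  linear_combination (a i x.1 + c * a j x.1) * (b i x.2 + star c * b j x.2) * h2 +
    1 / 2 * a j x.1 * b j x.2 * hc

theorem prodVec_mixPair_right (a : K → A → ℂ) (b : K → B → ℂ) {i j : K} (hij : i ≠ j) {c : ℂ}
    (hc : star c * c = 1) :
    prodVec (mixPair a i j c j) (mixPair b i j (star c) j) =
      ((1 / 2 : ℝ) : ℂ) • ((prodVec (a i) (b i) + prodVec (a j) (b j)) -
        (c • prodVec (a j) (b i) + star c • prodVec (a i) (b j))) := by
  have h2 := ofReal_inv_sqrt_two_mul_self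
  rw [mixPair_right _ hij, mixPair_right _ hij]
  generalize ((1 / √2 : ℝ) : ℂ) = r at h2 ⊢
  ext x
  simp only [prodVec, Pi.smul_apply, Pi.add_apply, Pi.sub_apply, smul_eq_mul, Complex.ofReal_div,
    Complex.ofReal_one, Complex.ofReal_ofNat]
  linear_combination (a i x.1 - c * a j x.1) * (b i x.2 - star c * b j x.2) * h2 +
    1 / 2 * a j x.1 * b j x.2 * hc

variable [Fintype A] [Fintype B] [Fintype K]

/-- Mixing two terms of equal weight in a Schmidt decomposition. -/
theorem IsSchmidt.mixPair {lam : K → ℝ} {ψ : A × B → ℂ} {a : K → A → ℂ} {b : K → B → ℂ}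
    (h : IsSchmidt lam ψ a b) {i j : K} (hij : i ≠ j) (hl : lam i = lam j) {c : ℂ}
    (hc : star c * c = 1) :
    IsSchmidt lam ψ (mixPair a i j c) (_root_.mixPair b i j (star c)) := by
  refine ⟨star_mixPair_dotProduct h.left hij hc, star_mixPair_dotProduct h.right hij
    (by rw [star_star, mul_comm, hc]), fun x => ?_⟩
  rw [h.eq]
  refine sum_eq_sum_of_pair hij (fun k hi hj => ?_) ?_
  · rw [mixPair_of_ne _ hi hj, mixPair_of_ne _ hi hj]
  · have h1 := congrFun (prodVec_mixPair_left a b i j hc) x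
    have h2 := congrFun (prodVec_mixPair_right a b hij hc) x
    simp only [prodVec, Pi.smul_apply, Pi.add_apply, Pi.sub_apply, smul_eq_mul, Complex.ofReal_div,
      Complex.ofReal_one, Complex.ofReal_ofNat] at h1 h2
    rw [← hl, ← mul_add, ← mul_add, h1, h2]
    ring

theorem norm_apply_le_one_of_dotProduct {A : Type} [Fintype A] {x : A → ℂ} (h : star x ⬝ᵥ x = 1) (i : A) :
    ‖x i‖ ≤ 1 := by
  have h1 : ∑ k, ‖x k‖ ^ 2 = 1 := by
    have := congrArg Complex.re h
    rw [dotProduct, Complex.re_sum, Complex.one_re] at this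
    rw [← this]
    refine Finset.sum_congr rfl fun k _ => ?_
    rw [Pi.star_apply, Complex.star_def, mul_comm, Complex.mul_conj, Complex.ofReal_re,
      Complex.normSq_eq_norm_sq]
  have h2 := Finset.single_le_sum (f := fun k => ‖x k‖ ^ 2) (fun k _ => sq_nonneg _)
    (Finset.mem_univ i)
  rw [h1] at h2
  exact (sq_le_one_iff₀ (norm_nonneg _)).1 h2

/-- The Schmidt decompositions of a vector form a compact set. -/
theorem isCompact_setOf_isSchmidt (lam : K → ℝ) (ψ : A × B → ℂ) :
    IsCompact {ab : (K → A → ℂ) × (K → B → ℂ) | IsSchmidt lam ψ ab.1 ab.2} := by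
  refine (isCompact_closedBall (0 : (K → A → ℂ) × (K → B → ℂ)) 1).of_isClosed_subset ?_ ?_
  · have : {ab : (K → A → ℂ) × (K → B → ℂ) | IsSchmidt lam ψ ab.1 ab.2} =
        {ab | ∀ i j, star (ab.1 i) ⬝ᵥ ab.1 j = if i = j then 1 else 0} ∩
        ({ab | ∀ i j, star (ab.2 i) ⬝ᵥ ab.2 j = if i = j then 1 else 0} ∩
        {ab | ∀ x, ψ x = ∑ k, ((√(lam k) : ℝ) : ℂ) * (ab.1 k x.1 * ab.2 k x.2)}) := by
      ext ab
      exact ⟨fun h => ⟨h.left, h.right, h.eq⟩, fun h => ⟨h.1, h.2.1, h.2.2⟩⟩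
    rw [this]
    simp only [Set.ofPred_forall]
    refine IsClosed.inter (isClosed_iInter fun i => isClosed_iInter fun j => ?_)
      (IsClosed.inter (isClosed_iInter fun i => isClosed_iInter fun j => ?_)
        (isClosed_iInter fun x => ?_))
    · exact isClosed_eq (by simp only [dotProduct, Pi.star_apply]; fun_prop) continuous_const
    · exact isClosed_eq (by simp only [dotProduct, Pi.star_apply]; fun_prop) continuous_const
    · exact isClosed_eq continuous_const (by fun_prop)
  · rintro ⟨a, b⟩ h
    rw [mem_closedBall_zero_iff, Prod.norm_def, max_le_iff]
    constructor
    · refine (pi_norm_le_iff_of_nonneg zero_le_one).2 fun k =>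
        (pi_norm_le_iff_of_nonneg zero_le_one).2 fun x => ?_
      exact norm_apply_le_one_of_dotProduct ((h.left k k).trans (if_pos rfl)) x
    · refine (pi_norm_le_iff_of_nonneg zero_le_one).2 fun k =>
        (pi_norm_le_iff_of_nonneg zero_le_one).2 fun x => ?_
      exact norm_apply_le_one_of_dotProduct ((h.right k k).trans (if_pos rfl)) x

/-- Degenerate weights leave freedom in the Schmidt bases; this selects bases adapted to `σ`, the
minimum being attained by compactness. -/
theorem IsSchmidt.exists_min {lam : K → ℝ} {ψ : A × B → ℂ} {a : K → A → ℂ} {b : K → B → ℂ}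
    (h : IsSchmidt lam ψ a b) (σ : Matrix (A × B) (A × B) ℂ) :
    ∃ a b, IsSchmidt lam ψ a b ∧ ∀ a' b', IsSchmidt lam ψ a' b' →
      ∑ k, (star (prodVec (a k) (b k)) ⬝ᵥ σ *ᵥ prodVec (a k) (b k)).re ≤
        ∑ k, (star (prodVec (a' k) (b' k)) ⬝ᵥ σ *ᵥ prodVec (a' k) (b' k)).re := by
  have hcont : Continuous fun ab : (K → A → ℂ) × (K → B → ℂ) =>
      ∑ k, (star (prodVec (ab.1 k) (ab.2 k)) ⬝ᵥ σ *ᵥ prodVec (ab.1 k) (ab.2 k)).re := by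
    refine continuous_finsetSum _ fun k _ => Complex.continuous_re.comp ?_
    have hp : Continuous fun ab : (K → A → ℂ) × (K → B → ℂ) => prodVec (ab.1 k) (ab.2 k) := by
      refine continuous_pi fun x => ?_
      simp only [prodVec]
      fun_prop
    exact Continuous.dotProduct (continuous_star.comp hp) (continuous_const.matrix_mulVec hp)
  obtain ⟨ab, h0, hmin⟩ := (isCompact_setOf_isSchmidt lam ψ).exists_isMinOn
    ⟨(a, b), h⟩ hcont.continuousOn
  exact ⟨ab.1, ab.2, h0, fun a' b' h' => isMinOn_iff.1 hmin (a', b') h'⟩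

end Mixing

/-! ### The pair inequality from optimality and positive partial transpose -/

section PairBound

variable {A B K : Type} [Fintype A] [Fintype B] [Fintype K] [DecidableEq K]

theorem re_dotProduct_smul {n : Type} [Fintype n] (σ : Matrix n n ℂ) (c : ℂ) (x : n → ℂ) :
    (star (c • x) ⬝ᵥ σ *ᵥ (c • x)).re = ‖c‖ ^ 2 * (star x ⬝ᵥ σ *ᵥ x).re := by
  rw [star_smul, mulVec_smul, smul_dotProduct, dotProduct_smul, smul_eq_mul, smul_eq_mul,
    ← mul_assoc, ← Complex.re_ofReal_mul, Complex.ofReal_pow, ← Complex.conj_mul', Complex.star_def]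

theorem re_dotProduct_parallelogram {n : Type} [Fintype n] (σ : Matrix n n ℂ) (x y : n → ℂ) :
    (star (x + y) ⬝ᵥ σ *ᵥ (x + y)).re + (star (x - y) ⬝ᵥ σ *ᵥ (x - y)).re =
      2 * (star x ⬝ᵥ σ *ᵥ x).re + 2 * (star y ⬝ᵥ σ *ᵥ y).re := by
  simp only [star_add, star_sub, mulVec_add, mulVec_sub, add_dotProduct, sub_dotProduct,
    dotProduct_add, dotProduct_sub, Complex.add_re, Complex.sub_re]
  ring

/-- Converts the coherence between `a_i ⊗ b_i` and `a_j ⊗ b_j` into a matrix element of the partial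
transpose between `a_i ⊗ b̄_j` and `a_j ⊗ b̄_i`, whose diagonal values are those of `σ` at `a_i ⊗
b_j` and `a_j ⊗ b_i`. -/
theorem dotProduct_partialTranspose (σ : Matrix (A × B) (A × B) ℂ) (a a' : A → ℂ) (b b' : B → ℂ) :
    star (prodVec a (star b')) ⬝ᵥ partialTranspose σ *ᵥ prodVec a' (star b) =
      star (prodVec a b) ⬝ᵥ σ *ᵥ prodVec a' b' := by
  simp only [dotProduct, mulVec, prodVec, Pi.star_apply, star_mul', star_star, partialTranspose,
    of_apply, Fintype.sum_prod_type, Finset.mul_sum]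
  refine Finset.sum_congr rfl fun x _ => ?_
  rw [Finset.sum_comm]
  conv_rhs => rw [Finset.sum_comm]
  refine Finset.sum_congr rfl fun y _ => ?_
  rw [Finset.sum_comm]
  refine Finset.sum_congr rfl fun z _ => Finset.sum_congr rfl fun w _ => ?_
  ring

/-- If a Schmidt decomposition minimizes `∑ ⟨a_k b_k|σ|a_k b_k⟩`, then the diagonal terms of equal
weight are controlled by the off-diagonal ones. -/
theorem IsSchmidt.diag_add_diag_le {lam : K → ℝ} {ψ : A × B → ℂ} {a : K → A → ℂ} {b : K → B → ℂ}
    (h : IsSchmidt lam ψ a b) {σ : Matrix (A × B) (A × B) ℂ}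
    (hσ : (partialTranspose σ).PosSemidef)
    (hmin : ∀ a' b', IsSchmidt lam ψ a' b' →
      ∑ k, (star (prodVec (a k) (b k)) ⬝ᵥ σ *ᵥ prodVec (a k) (b k)).re ≤
        ∑ k, (star (prodVec (a' k) (b' k)) ⬝ᵥ σ *ᵥ prodVec (a' k) (b' k)).re)
    {i j : K} (hij : i ≠ j) (hl : lam i = lam j) :
    (star (prodVec (a i) (b i)) ⬝ᵥ σ *ᵥ prodVec (a i) (b i)).re +
      (star (prodVec (a j) (b j)) ⬝ᵥ σ *ᵥ prodVec (a j) (b j)).re ≤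
      2 * ((star (prodVec (a i) (b j)) ⬝ᵥ σ *ᵥ prodVec (a i) (b j)).re +
        (star (prodVec (a j) (b i)) ⬝ᵥ σ *ᵥ prodVec (a j) (b i)).re) := by
  have key : ∀ c : ℂ, star c * c = 1 →
      2 * ((star (prodVec (a i) (b i)) ⬝ᵥ σ *ᵥ prodVec (a i) (b i)).re +
      (star (prodVec (a j) (b j)) ⬝ᵥ σ *ᵥ prodVec (a j) (b j)).re) ≤
      (star (prodVec (a i) (b i) + prodVec (a j) (b j)) ⬝ᵥ
        σ *ᵥ (prodVec (a i) (b i) + prodVec (a j) (b j))).re +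
      (star (c • prodVec (a j) (b i) + star c • prodVec (a i) (b j)) ⬝ᵥ
        σ *ᵥ (c • prodVec (a j) (b i) + star c • prodVec (a i) (b j))).re := by
    intro c hc
    have h1 := hmin _ _ (h.mixPair hij hl hc)
    set f := fun k => (star (prodVec (a k) (b k)) ⬝ᵥ σ *ᵥ prodVec (a k) (b k)).re with hf
    set g := fun k => (star (prodVec (_root_.mixPair a i j c k) (_root_.mixPair b i j (star c) k))
      ⬝ᵥ σ *ᵥ prodVec (_root_.mixPair a i j c k) (_root_.mixPair b i j (star c) k)).re with hg
    have h2 : f i + f j ≤ g i + g j := by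
      rw [← sub_nonneg, ← Finset.sum_sub_distrib, Fintype.sum_eq_add i j hij fun k hk => ?_] at h1
      · linarith
      · simp only [mixPair_of_ne _ hk.1 hk.2, sub_self]
    have h3 := re_dotProduct_parallelogram σ (prodVec (a i) (b i) + prodVec (a j) (b j))
      (c • prodVec (a j) (b i) + star c • prodVec (a i) (b j))
    have hhalf : ‖((1 / 2 : ℝ) : ℂ)‖ ^ 2 = 1 / 4 := by
      rw [Complex.norm_real]
      norm_num
    simp only [hf, hg, prodVec_mixPair_left a b i j hc, prodVec_mixPair_right a b hij hc,
      re_dotProduct_smul, hhalf] at h2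
    linarith
  -- Adding the cases `c = 1` and `c = i` cancels the interference between the two off-diagonal
  -- products, by the parallelogram law.
  have k1 := key 1 (by simp)
  have kI := key Complex.I (by simp)
  have e1 : (1 : ℂ) • prodVec (a j) (b i) + star (1 : ℂ) • prodVec (a i) (b j) =
      prodVec (a j) (b i) + prodVec (a i) (b j) := by simp
  have eI : Complex.I • prodVec (a j) (b i) + star Complex.I • prodVec (a i) (b j) =
      Complex.I • (prodVec (a j) (b i) - prodVec (a i) (b j)) := by
    rw [smul_sub, sub_eq_add_neg]
    simp
  rw [e1] at k1
  rw [eI, re_dotProduct_smul, Complex.norm_I, one_pow, one_mul] at kI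
  have h4 := re_dotProduct_parallelogram σ (prodVec (a j) (b i)) (prodVec (a i) (b j))
  -- The remaining coherence between the two diagonal products is bounded here by the off-diagonal
  -- populations; this is where the positive partial transpose enters.
  have h5 := re_dotProduct_add_le hσ (prodVec (a i) (star (b j))) (prodVec (a j) (star (b i)))
  simp only [dotProduct_partialTranspose] at h5
  have h6 : (star (prodVec (a i) (b i) + prodVec (a j) (b j)) ⬝ᵥ
        σ *ᵥ (prodVec (a i) (b i) + prodVec (a j) (b j))).re =
      (star (prodVec (a i) (b i)) ⬝ᵥ σ *ᵥ prodVec (a i) (b i)).re +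
      (star (prodVec (a j) (b j)) ⬝ᵥ σ *ᵥ prodVec (a j) (b j)).re +
      ((star (prodVec (a i) (b i)) ⬝ᵥ σ *ᵥ prodVec (a j) (b j)).re +
      (star (prodVec (a j) (b j)) ⬝ᵥ σ *ᵥ prodVec (a i) (b i)).re) := by
    simp only [star_add, mulVec_add, add_dotProduct, dotProduct_add, Complex.add_re]
    ring
  linarith

/-- The weighted form of `IsSchmidt.diag_add_diag_le`, summed over all pairs of terms. -/
theorem IsSchmidt.sum_card_mul_le {lam : K → ℝ} {ψ : A × B → ℂ} {a : K → A → ℂ} {b : K → B → ℂ}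
    (h : IsSchmidt lam ψ a b) {σ : Matrix (A × B) (A × B) ℂ} (hσ0 : σ.PosSemidef)
    (hσ : (partialTranspose σ).PosSemidef)
    (hmin : ∀ a' b', IsSchmidt lam ψ a' b' →
      ∑ k, (star (prodVec (a k) (b k)) ⬝ᵥ σ *ᵥ prodVec (a k) (b k)).re ≤
        ∑ k, (star (prodVec (a' k) (b' k)) ⬝ᵥ σ *ᵥ prodVec (a' k) (b' k)).re) :
    ∑ k, ((Finset.univ.filter fun l => lam l = lam k).card + 1 : ℝ) *
      (star (prodVec (a k) (b k)) ⬝ᵥ σ *ᵥ prodVec (a k) (b k)).re ≤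
      2 * ∑ k, ∑ l, (star (prodVec (a k) (b l)) ⬝ᵥ σ *ᵥ prodVec (a k) (b l)).re := by
  set s : K → K → ℝ := fun k l =>
    (star (prodVec (a k) (b l)) ⬝ᵥ σ *ᵥ prodVec (a k) (b l)).re with hs
  have hs0 : ∀ k l, 0 ≤ s k l := fun k l => hσ0.re_dotProduct_nonneg _
  -- The case `k = l` has `4 s_kk` on the right, of which the first two terms use only `2 s_kk`. The
  -- extra `2 s_kk` becomes the `+ 1` next to the multiplicity.
  have hpair : ∀ k l, ((if lam l = lam k then s k k else 0) +
      (if lam k = lam l then s l l else 0)) + (if k = l then 2 * s k k else 0) ≤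
      2 * s k l + 2 * s l k := by
    intro k l
    by_cases hkl : k = l
    · subst hkl
      simp only [if_true]
      linarith
    · by_cases hl : lam k = lam l
      · have := h.diag_add_diag_le hσ hmin hkl hl
        rw [if_pos hl.symm, if_pos hl, if_neg hkl]
        simp only [hs]
        linarith
      · rw [if_neg (Ne.symm hl), if_neg hl, if_neg hkl]
        linarith [hs0 k l, hs0 l k]
  have hsum := Finset.sum_le_sum fun k (_ : k ∈ Finset.univ) =>
    Finset.sum_le_sum fun l (_ : l ∈ Finset.univ) => hpair k l
  simp only [Finset.sum_add_distrib] at hsum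
  rw [Finset.sum_comm (f := fun k l => if lam k = lam l then s l l else 0),
    Finset.sum_comm (f := fun k l => 2 * s l k)] at hsum
  have hcard : ∀ k, ∑ l, (if lam l = lam k then s k k else 0) =
      ((Finset.univ.filter fun l => lam l = lam k).card : ℝ) * s k k := fun k => by
    rw [← Finset.sum_filter, Finset.sum_const, nsmul_eq_mul]
  simp only [hcard, Finset.sum_ite_eq, Finset.mem_univ, if_true, ← Finset.mul_sum] at hsum
  simp only [add_mul, one_mul, Finset.sum_add_distrib]
  linarith

end PairBound

/-! ### Lower bound by local measurements -/

theorem IsSeparableState.posSemidef {A B : Type} [Fintype A] [Fintype B]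
    {σ : Matrix (A × B) (A × B) ℂ} (hσ : IsSeparableState σ) : σ.PosSemidef := by
  classical
  obtain ⟨m, p, α, β, hp, -, hα, hβ, rfl⟩ := hσ
  exact posSemidef_sum _ fun j _ => ((hα j).1.kronecker (hβ j).1).smul
    (Complex.zero_le_real.2 (hp j))

theorem IsSeparableState.partialTranspose_posSemidef {A B : Type} [Fintype A] [Fintype B]
    {σ : Matrix (A × B) (A × B) ℂ} (hσ : IsSeparableState σ) :
    (partialTranspose σ).PosSemidef := by
  classical
  obtain ⟨m, p, α, β, hp, -, hα, hβ, rfl⟩ := hσ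
  rw [partialTranspose_sum]
  refine posSemidef_sum _ fun j _ => ?_
  have : partialTranspose ((p j : ℂ) • (α j ⊗ₖ β j)) = (p j : ℂ) • (α j ⊗ₖ (β j)ᵀ) := by
    rw [← partialTranspose_kronecker]
    rfl
  rw [this]
  exact ((hα j).1.kronecker (hβ j).1.transpose).smul (Complex.zero_le_real.2 (hp j))

theorem IsSeparableState.trace_eq_one {A B : Type} [Fintype A] [Fintype B]
    {σ : Matrix (A × B) (A × B) ℂ} (hσ : IsSeparableState σ) : σ.trace = 1 := by
  obtain ⟨m, p, α, β, -, hp1, hα, hβ, rfl⟩ := hσ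
  simp only [trace_sum, trace_smul, trace_kronecker, (hα _).2, (hβ _).2, mul_one, smul_eq_mul]
  rw [← Complex.ofReal_sum, hp1, Complex.ofReal_one]

/-- The projective measurement on an orthonormal family, completed by its complement. -/
def orthonormalPOVM {n K : Type} [DecidableEq n] [Fintype K] (a : K → n → ℂ) :
    Option K → Matrix n n ℂ
  | some k => vecMulVec (a k) (star (a k))
  | none => 1 - ∑ k, vecMulVec (a k) (star (a k))

theorem isPOVM_orthonormalPOVM {n K : Type} [Fintype n] [DecidableEq n] [Fintype K]
    [DecidableEq K] {a : K → n → ℂ} (ha : ∀ k l, star (a k) ⬝ᵥ a l = if k = l then 1 else 0) :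
    IsPOVM (orthonormalPOVM a) := by
  have hP : (∑ k, vecMulVec (a k) (star (a k))) * (∑ k, vecMulVec (a k) (star (a k))) =
      ∑ k, vecMulVec (a k) (star (a k)) := by
    rw [Finset.sum_mul_sum]
    refine Finset.sum_congr rfl fun k _ => ?_
    simp only [vecMulVec_mul_vecMulVec, ha]
    rw [Finset.sum_eq_single k (fun l _ hl => by simp [hl.symm]) (by simp)]
    simp
  have hH : (∑ k, vecMulVec (a k) (star (a k)))ᴴ = ∑ k, vecMulVec (a k) (star (a k)) := by
    rw [conjTranspose_sum]
    exact Finset.sum_congr rfl fun k _ => (posSemidef_vecMulVec_self_star (a k)).1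
  refine ⟨?_, ?_⟩
  · rintro (_ | k)
    · have : orthonormalPOVM a none = (orthonormalPOVM a none)ᴴ * orthonormalPOVM a none := by
        simp only [orthonormalPOVM, conjTranspose_sub, conjTranspose_one, hH, mul_sub, sub_mul,
          hP, mul_one, one_mul]
        abel
      rw [this]
      exact posSemidef_conjTranspose_mul_self _
    · exact posSemidef_vecMulVec_self_star (a k)
  · rw [Fintype.sum_option]
    simp [orthonormalPOVM]

theorem IsPOVM.comp_equiv {n ι κ : Type} [DecidableEq n] [Fintype ι] [Fintype κ]
    {M : ι → Matrix n n ℂ} (hM : IsPOVM M) (e : κ ≃ ι) : IsPOVM (M ∘ e) :=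
  ⟨fun _ => hM.1 _, (Equiv.sum_comp e M).trans hM.2⟩

theorem IsPOVM.exists_isLO {A B κ κ' : Type} [DecidableEq A] [DecidableEq B] [Fintype κ]
    [Fintype κ'] {R : κ → Matrix A A ℂ} {S : κ' → Matrix B B ℂ} (hR : IsPOVM R) (hS : IsPOVM S) :
    ∃ (k : ℕ) (e : Fin k ≃ κ × κ'), IsLO fun i => R (e i).1 ⊗ₖ S (e i).2 := by
  let e := (Fintype.equivFin (κ × κ')).symm
  refine ⟨Fintype.card (κ × κ'), e, Fintype.card κ, Fintype.card κ',
    R ∘ (Fintype.equivFin κ).symm, S ∘ (Fintype.equivFin κ').symm,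
    e.trans (Equiv.prodCongr (Fintype.equivFin κ) (Fintype.equivFin κ')),
    hR.comp_equiv _, hS.comp_equiv _, fun _ => ?_⟩
  simp

theorem trace_mul_re_nonneg {n : Type} [Fintype n] {σ M : Matrix n n ℂ} (hσ : σ.PosSemidef)
    (hM : M.PosSemidef) : 0 ≤ (σ * M).trace.re := by
  obtain ⟨K, rfl⟩ := exists_conjTranspose_mul_self_eq hM
  rw [← Matrix.mul_assoc, trace_mul_comm, ← Matrix.mul_assoc]
  exact (Complex.nonneg_iff.1 (hσ.mul_mul_conjTranspose_same K).trace_nonneg).1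

/-- A lower bound on the relative entropy when the first distribution is supported on the range
of an injection. -/
theorem sum_mul_logb_le_relEntropy {ι K : Type} [Fintype ι] [Fintype K] {p q : ι → ℝ}
    {lam w : K → ℝ} {f : K → ι} (hf : Function.Injective f) (hp0 : ∀ i, 0 ≤ p i)
    (hp : ∀ k, p (f k) = lam k) (hp1 : ∑ i, p i = 1) (hlam : ∀ k, 0 < lam k)
    (hlam1 : ∑ k, lam k = 1) (hq0 : ∀ i, 0 ≤ q i) (hw : ∀ k, 0 < w k)
    (h : ∑ k, w k * q (f k) ≤ 1) :
    ((∑ k, lam k * Real.logb 2 (w k) : ℝ) : EReal) ≤ relEntropy p q := by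
  classical
  rw [relEntropy]
  split_ifs with hs
  swap
  · exact le_top
  have hq : ∀ k, 0 < q (f k) := fun k =>
    (hq0 _).lt_of_ne' fun h0 => (hlam k).ne' (by rw [← hp, hs _ h0])
  -- The outcomes `f k` already carry the whole mass of `p`, so `p` vanishes elsewhere.
  have himg : ∑ i ∈ Finset.univ.image f, p i = 1 := by
    rw [Finset.sum_image fun _ _ _ _ h => hf h, ← hlam1]
    exact Finset.sum_congr rfl fun k _ => hp k
  have hzero : ∀ i, i ∉ Finset.univ.image f → p i = 0 := by
    have h1 := Finset.sum_add_sum_compl (Finset.univ.image f) p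
    rw [himg, hp1, add_eq_left, Finset.sum_eq_zero_iff_of_nonneg fun i _ => hp0 i] at h1
    exact fun i hi => h1 i (Finset.mem_compl.2 hi)
  have hsum : ∑ i, p i * Real.logb 2 (p i / q i) =
      ∑ k, lam k * Real.logb 2 (lam k / q (f k)) := by
    rw [← Finset.sum_subset (Finset.subset_univ (Finset.univ.image f)) fun i _ hi => by
      rw [hzero i hi, zero_mul], Finset.sum_image fun _ _ _ _ h => hf h]
    exact Finset.sum_congr rfl fun k _ => by rw [hp]
  rw [hsum, EReal.coe_le_coe_iff]
  have hl : 0 < Real.log 2 := Real.log_pos one_lt_two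
  simp only [Real.logb, mul_div_assoc', ← Finset.sum_div]
  refine div_le_div_of_nonneg_right ?_ hl.le
  -- Gibbs' inequality, from `log x ≤ x - 1` at `x = w q / λ`. The right sides sum to at most `1 - 1
  -- = 0`.
  have hk : ∀ k, lam k * Real.log (w k) - lam k * Real.log (lam k / q (f k)) ≤
      w k * q (f k) - lam k := by
    intro k
    have h1 := Real.log_le_sub_one_of_pos (div_pos (mul_pos (hw k) (hq k)) (hlam k))
    have h2 : Real.log (w k * q (f k) / lam k) =
        Real.log (w k) - Real.log (lam k / q (f k)) := by
      rw [Real.log_div (mul_pos (hw k) (hq k)).ne' (hlam k).ne', Real.log_mul (hw k).ne' (hq k).ne',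
        Real.log_div (hlam k).ne' (hq k).ne']
      ring
    rw [← mul_sub, ← h2]
    refine (mul_le_mul_of_nonneg_left h1 (hlam k).le).trans_eq ?_
    have := (hlam k).ne'
    field_simp
  have h1 := Finset.sum_le_sum fun k (_ : k ∈ Finset.univ) => hk k
  rw [Finset.sum_sub_distrib, Finset.sum_sub_distrib, hlam1] at h1
  linarith

theorem trace_mul_vecMulVec_star {n : Type} [Fintype n] (σ : Matrix n n ℂ) (x : n → ℂ) :
    (σ * vecMulVec x (star x)).trace = star x ⬝ᵥ σ *ᵥ x := by
  rw [mul_vecMulVec, trace_vecMulVec, dotProduct_comm]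

theorem IsSchmidt.star_prodVec_dotProduct {A B K : Type} [Fintype A] [Fintype B] [Fintype K]
    [DecidableEq K] {lam : K → ℝ} {ψ : A × B → ℂ} {a : K → A → ℂ} {b : K → B → ℂ}
    (h : IsSchmidt lam ψ a b) (k : K) :
    star (prodVec (a k) (b k)) ⬝ᵥ ψ = ((√(lam k) : ℝ) : ℂ) := by
  have : ψ = ∑ l, ((√(lam l) : ℝ) : ℂ) • prodVec (a l) (b l) := by
    ext x
    rw [h.eq, Finset.sum_apply]
    rfl
  rw [this, dotProduct_sum]
  simp [dotProduct_smul, _root_.star_prodVec_dotProduct, h.left, h.right]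

theorem IsSchmidt.star_dotProduct_self {A B K : Type} [Fintype A] [Fintype B] [Fintype K]
    [DecidableEq K] {lam : K → ℝ} {ψ : A × B → ℂ} {a : K → A → ℂ} {b : K → B → ℂ}
    (h : IsSchmidt lam ψ a b) (hlam : ∀ k, 0 < lam k) (hlam1 : ∑ k, lam k = 1) :
    star ψ ⬝ᵥ ψ = 1 := by
  have hψ : ψ = ∑ l, ((√(lam l) : ℝ) : ℂ) • prodVec (a l) (b l) := by
    ext x
    rw [h.eq, Finset.sum_apply]
    rfl
  have : star ψ = ∑ l, ((√(lam l) : ℝ) : ℂ) • star (prodVec (a l) (b l)) := by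
    rw [hψ, star_sum]
    refine Finset.sum_congr rfl fun l _ => ?_
    rw [star_smul, Complex.star_def, Complex.conj_ofReal]
  rw [this, sum_dotProduct]
  simp only [smul_dotProduct, h.star_prodVec_dotProduct, smul_eq_mul, ← Complex.ofReal_mul,
    Real.mul_self_sqrt (hlam _).le]
  rw [← Complex.ofReal_sum, hlam1, Complex.ofReal_one]

/-- Local measurements in an optimal Schmidt basis bound the measured relative entropy of
entanglement from below. -/
theorem IsSchmidt.le_measuredREE {A B K : Type} [Fintype A] [DecidableEq A] [Fintype B]
    [DecidableEq B] [Fintype K] [DecidableEq K] {lam : K → ℝ} {ψ : A × B → ℂ} {a : K → A → ℂ}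
    {b : K → B → ℂ} (h : IsSchmidt lam ψ a b) (hlam : ∀ k, 0 < lam k) (hlam1 : ∑ k, lam k = 1)
    (C : MeasClass) :
    ((∑ k, lam k * Real.logb 2
      (((Finset.univ.filter fun l => lam l = lam k).card + 1) / 2) : ℝ) : EReal) ≤
      measuredREE C (pureState ψ) := by
  refine le_iInf₂ fun σ hσ => ?_
  -- The measurement bases may depend on `σ`, since the supremum is inside the infimum.
  obtain ⟨a, b, h, hmin⟩ := h.exists_min σ
  have hA := isPOVM_orthonormalPOVM h.left
  have hB := isPOVM_orthonormalPOVM h.right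
  obtain ⟨m, e, hM⟩ := hA.exists_isLO hB
  set M := fun i => orthonormalPOVM a (e i).1 ⊗ₖ orthonormalPOVM b (e i).2 with hMdef
  refine le_trans ?_ (le_iSup_of_le m (le_iSup₂_of_le M (MeasClass.mem_of_isLO hM C) le_rfl))
  have hPOVM : IsPOVM M := hM.isSEP.1
  have hMe : ∀ k l, M (e.symm (some k, some l)) =
      vecMulVec (prodVec (a k) (b l)) (star (prodVec (a k) (b l))) := fun k l => by
    simp [hMdef, orthonormalPOVM, vecMulVec_prodVec]
  have hq0 : ∀ i, 0 ≤ outcomeDist M σ i := fun i => trace_mul_re_nonneg hσ.posSemidef (hPOVM.1 i)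
  have hqe : ∀ k l, outcomeDist M σ (e.symm (some k, some l)) =
      (star (prodVec (a k) (b l)) ⬝ᵥ σ *ᵥ prodVec (a k) (b l)).re := fun k l => by
    rw [outcomeDist, hMe, trace_mul_vecMulVec_star]
  have hinj : Function.Injective fun x : K × K => e.symm (some x.1, some x.2) := by
    rintro ⟨k, l⟩ ⟨k', l'⟩ hkl
    simpa using hkl
  have hqsum : ∑ k, ∑ l, (star (prodVec (a k) (b l)) ⬝ᵥ σ *ᵥ prodVec (a k) (b l)).re ≤ 1 := by
    have h1 := sum_outcomeDist hPOVM σ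
    rw [hσ.trace_eq_one, Complex.one_re] at h1
    simp_rw [← hqe]
    rw [← h1, ← Fintype.sum_prod_type' (f := fun k l =>
      outcomeDist M σ (e.symm (some k, some l))),
      ← Finset.sum_image (g := fun x : K × K => e.symm (some x.1, some x.2)) (f := outcomeDist M σ)
        fun _ _ _ _ h => hinj h]
    exact Finset.sum_le_sum_of_subset_of_nonneg (Finset.subset_univ _) fun _ _ _ => hq0 _
  refine sum_mul_logb_le_relEntropy (f := fun k => e.symm (some k, some k)) ?_ (fun i => ?_)
    (fun k => ?_) ?_ hlam hlam1 hq0 (fun _ => by positivity) ?_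
  · exact fun k l hkl => congrArg Prod.fst (hinj (a₁ := (k, k)) (a₂ := (l, l)) hkl)
  · rw [pureState, outcomeDist_vecMulVec]
    exact (hPOVM.1 i).re_dotProduct_nonneg _
  · have h1 := h.star_prodVec_dotProduct k
    rw [outcomeDist, hMe, trace_mul_vecMulVec_star, pureState, vecMulVec_mulVec]
    simp only [op_smul_eq_smul, dotProduct_smul, h1]
    rw [star_dotProduct, h1]
    simp [← Complex.ofReal_mul, Real.mul_self_sqrt (hlam k).le]
  · rw [sum_outcomeDist hPOVM, pureState, trace_vecMulVec, dotProduct_comm,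
      h.star_dotProduct_self hlam hlam1, Complex.one_re]
  · have h1 := h.sum_card_mul_le hσ.posSemidef hσ.partialTranspose_posSemidef hmin
    simp_rw [hqe, div_mul_eq_mul_div, ← Finset.sum_div]
    linarith

/-! ### Existence of Schmidt decompositions -/

theorem sum_subtype_eq_sum {K R : Type*} [Fintype K] [AddCommMonoid R] {p : K → Prop}
    [DecidablePred p] {f : K → R} (h : ∀ k, ¬p k → f k = 0) :
    ∑ k : {k // p k}, f k = ∑ k, f k := by
  rw [← Finset.sum_subtype (Finset.univ.filter p) (by simp) f]
  exact Finset.sum_filter_of_ne fun k _ hk => by_contra fun hp => hk (h k hp)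

theorem vonNeumannEntropy_eq_sum_eigenvalues {n : Type} [Fintype n] [DecidableEq n]
    {ρ : Matrix n n ℂ} (hρ : ρ.IsHermitian) :
    vonNeumannEntropy ρ = -∑ k, hρ.eigenvalues k * Real.logb 2 (hρ.eigenvalues k) := by
  have h : ρ * cfc (Real.logb 2) ρ = (Unitary.conjStarAlgAut ℂ _ hρ.eigenvectorUnitary)
      (diagonal fun k =>
        ((hρ.eigenvalues k * Real.logb 2 (hρ.eigenvalues k) : ℝ) : ℂ)) := by
    rw [hρ.cfc_eq, IsHermitian.cfc]
    nth_rewrite 1 [hρ.spectral_theorem]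
    rw [← map_mul, diagonal_mul_diagonal]
    simp
  rw [vonNeumannEntropy, h, Unitary.conjStarAlgAut_apply, trace_mul_comm, ← Matrix.mul_assoc,
    Unitary.coe_star_mul_self, Matrix.one_mul, trace_diagonal, ← Complex.ofReal_sum,
    Complex.ofReal_re]

/-- Every unit vector has a Schmidt decomposition with positive coefficients, and its entropy of
entanglement is the Shannon entropy of their squares. -/
theorem exists_isSchmidt {A B : Type} [Fintype A] [DecidableEq A] [Fintype B] {ψ : A × B → ℂ}
    (hψ : ∑ x, ‖ψ x‖ ^ 2 = 1) :
    ∃ (K : Type) (_ : Fintype K) (_ : DecidableEq K) (lam : K → ℝ) (a : K → A → ℂ)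
      (b : K → B → ℂ), IsSchmidt lam ψ a b ∧ (∀ k, 0 < lam k) ∧ ∑ k, lam k = 1 ∧
        vonNeumannEntropy (traceB (pureState ψ)) = -∑ k, lam k * Real.logb 2 (lam k) := by
  -- The singular value decomposition of `ψ` read as a matrix: for an eigenbasis `U` of `Ψ Ψᴴ`, the
  -- rows of `Uᴴ Ψ` are orthogonal with squared norms the eigenvalues. Zero eigenvalues are dropped,
  -- and the other rows are normalized to give the vectors `b`.
  set Ψ : Matrix A B ℂ := of fun x y => ψ (x, y) with hΨ
  have hρ : traceB (pureState ψ) = Ψ * Ψᴴ := by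
    ext x x'
    simp [traceB, pureState, vecMulVec_apply, Matrix.mul_apply, hΨ]
  have hP : (Ψ * Ψᴴ).PosSemidef := posSemidef_self_mul_conjTranspose Ψ
  have hH := hP.1
  set ev := hH.eigenvalues with hev
  set U : Matrix A A ℂ := (hH.eigenvectorUnitary : Matrix A A ℂ) with hU
  have hUU : Uᴴ * U = 1 := Unitary.coe_star_mul_self hH.eigenvectorUnitary
  have hUU' : U * Uᴴ = 1 := Unitary.coe_mul_star_self hH.eigenvectorUnitary
  have hspec : Ψ * Ψᴴ = U * diagonal (fun k => (ev k : ℂ)) * Uᴴ := hH.spectral_theorem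
  have hdiag : (Uᴴ * Ψ) * (Uᴴ * Ψ)ᴴ = diagonal fun k => (ev k : ℂ) := by
    rw [conjTranspose_mul, conjTranspose_conjTranspose, Matrix.mul_assoc, ← Matrix.mul_assoc Ψ,
      hspec, Matrix.mul_assoc _ Uᴴ U, hUU, Matrix.mul_one, ← Matrix.mul_assoc, hUU, Matrix.one_mul]
  have hβ : ∀ k l, star ((Uᴴ * Ψ) k) ⬝ᵥ (Uᴴ * Ψ) l = if k = l then (ev k : ℂ) else 0 := by
    intro k l
    have := congrFun (congrFun hdiag l) k
    rw [Matrix.mul_apply, diagonal_apply] at this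
    rw [dotProduct_comm, dotProduct]
    simp only [conjTranspose_apply] at this
    simp only [Pi.star_apply, this]
    by_cases h : k = l
    · subst h
      simp
    · rw [if_neg h, if_neg (Ne.symm h)]
  have hev0 : ∀ k, 0 ≤ ev k := hP.eigenvalues_nonneg
  have hzero : ∀ k, ¬0 < ev k → ev k = 0 := fun k hk => (not_lt.1 hk).antisymm (hev0 k)
  have hβ0 : ∀ k, ¬0 < ev k → (Uᴴ * Ψ) k = 0 := fun k hk => by
    have := hβ k k
    rw [if_pos rfl, hzero k hk, Complex.ofReal_zero] at this
    exact dotProduct_star_self_eq_zero.1 this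
  have hfac : Ψ = U * (Uᴴ * Ψ) := by rw [← Matrix.mul_assoc, hUU', Matrix.one_mul]
  refine ⟨{k // 0 < ev k}, inferInstance, inferInstance, fun k => ev k, fun k x => U x k,
    fun k => ((1 / √(ev k) : ℝ) : ℂ) • (Uᴴ * Ψ) k, ⟨fun i j => ?_, fun i j => ?_, fun x => ?_⟩,
    fun k => k.2, ?_, ?_⟩
  · have := congrFun (congrFun hUU i) j
    rw [Matrix.mul_apply, Matrix.one_apply] at this
    simp only [Subtype.ext_iff]
    exact this
  · rw [star_smul, smul_dotProduct, dotProduct_smul, hβ]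
    simp only [Subtype.ext_iff]
    split_ifs with h
    · have h1 : √(ev i) ≠ 0 := (Real.sqrt_pos.2 i.2).ne'
      rw [← h, Complex.star_def, Complex.conj_ofReal, smul_eq_mul, smul_eq_mul,
        ← Complex.ofReal_mul, ← Complex.ofReal_mul, ← Complex.ofReal_one]
      congr 1
      nth_rewrite 3 [← Real.mul_self_sqrt (hev0 i)]
      field_simp
    · simp
  · have h1 : ψ x = ∑ k, U x.1 k * (Uᴴ * Ψ) k x.2 := by
      rw [← Matrix.mul_apply, ← hfac]
      rfl
    rw [h1, ← sum_subtype_eq_sum (p := fun k => 0 < ev k) fun k hk => by rw [hβ0 k hk]; simp]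
    refine Finset.sum_congr rfl fun k _ => ?_
    have h2 : ((√(ev k) : ℝ) : ℂ) * ((1 / √(ev k) : ℝ) : ℂ) = 1 := by
      rw [← Complex.ofReal_mul, mul_one_div_cancel (Real.sqrt_pos.2 k.2).ne', Complex.ofReal_one]
    rw [Pi.smul_apply, smul_eq_mul]
    linear_combination -(U x.1 k * (Uᴴ * Ψ) k x.2) * h2
  · rw [sum_subtype_eq_sum (p := fun k => 0 < ev k) hzero]
    have h1 := hH.trace_eq_sum_eigenvalues
    have h2 : (Ψ * Ψᴴ).trace = 1 := by
      rw [trace, ← Complex.ofReal_one, ← hψ, Fintype.sum_prod_type, Complex.ofReal_sum]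
      refine Finset.sum_congr rfl fun x _ => ?_
      rw [diag_apply, Matrix.mul_apply, Complex.ofReal_sum]
      refine Finset.sum_congr rfl fun y _ => ?_
      rw [conjTranspose_apply, hΨ, of_apply, Complex.star_def, Complex.mul_conj',
        Complex.ofReal_pow]
    rw [h2] at h1
    refine Complex.ofReal_eq_one.1 ?_
    rw [Complex.ofReal_sum]
    exact h1.symm
  · rw [hρ, vonNeumannEntropy_eq_sum_eigenvalues hH,
      sum_subtype_eq_sum (p := fun k => 0 < ev k)
        (f := fun k => ev k * Real.logb 2 (ev k)) fun k hk => by rw [hzero k hk, zero_mul]]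

/-! ### Lower bound for the maximally entangled state -/

theorem isSchmidt_maxEntangled (d : ℕ) :
    IsSchmidt (fun _ : Fin d => 1 / (d : ℝ))
      (fun x : Fin d × Fin d => if x.1 = x.2 then ((1 / Real.sqrt d : ℝ) : ℂ) else 0)
      (fun k => Pi.single k 1) fun k => Pi.single k 1 := by
  refine ⟨fun i j => ?_, fun i j => ?_, fun x => ?_⟩
  · simp [Pi.single_apply, eq_comm]
  · simp [Pi.single_apply, eq_comm]
  · simp [Pi.single_apply, eq_comm]

/-- All `d` Schmidt weights coincide, so every multiplicity in the general lower bound equals `d`.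
-/
theorem le_measuredREE_maxEntangled {d : ℕ} (hd : 0 < d) (C : MeasClass) :
    ((Real.logb 2 ((d : ℝ) + 1) - 1 : ℝ) : EReal) ≤ measuredREE C (maxEntangled d) := by
  have hd0 : (0 : ℝ) < d := Nat.cast_pos.2 hd
  have h := (isSchmidt_maxEntangled d).le_measuredREE (fun _ => one_div_pos.2 hd0)
    (by simp [hd0.ne']) C
  refine le_trans (le_of_eq ?_) h
  rw [EReal.coe_eq_coe_iff]
  simp only [Finset.filter_true, Finset.card_univ, Fintype.card_fin, Finset.sum_const, nsmul_eq_mul]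
  rw [Real.logb_div (by positivity) two_ne_zero, Real.logb_self_eq_one one_lt_two]
  field_simp

/-! ### Tensor powers -/

theorem tensorPower_pureState {A B : Type} (ψ : A × B → ℂ) (n : ℕ) :
    tensorPower (pureState ψ) n = pureState fun x => ∏ t, ψ (x.1 t, x.2 t) := by
  ext x y
  simp [tensorPower, pureState, vecMulVec_apply, Finset.prod_mul_distrib]

theorem sum_prod_pi {n : ℕ} {X R : Type*} [Fintype X] [CommSemiring R] (f : Fin n → X → R) :
    ∑ x : Fin n → X, ∏ t, f t (x t) = ∏ t, ∑ y, f t y := by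
  rw [Finset.prod_univ_sum, Fintype.piFinset_univ]

theorem star_prod_dotProduct_prod {n : ℕ} {A K : Type} [Fintype A] [DecidableEq K]
    {a : K → A → ℂ} (ha : ∀ k l, star (a k) ⬝ᵥ a l = if k = l then 1 else 0) (i j : Fin n → K) :
    star (fun x : Fin n → A => ∏ t, a (i t) (x t)) ⬝ᵥ (fun x => ∏ t, a (j t) (x t)) =
      if i = j then 1 else 0 := by
  simp only [dotProduct, Pi.star_apply, star_prod, ← Finset.prod_mul_distrib]
  rw [sum_prod_pi fun t y => star (a (i t) y) * a (j t) y]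
  have : ∀ t, ∑ y, star (a (i t) y) * a (j t) y = if i t = j t then 1 else 0 := fun t => ha _ _
  simp only [this, Finset.prod_ite_zero, Finset.prod_const_one, Finset.mem_univ, true_imp_iff,
    funext_iff]

theorem IsSchmidt.tensorPower {A B K : Type} [Fintype A] [Fintype B] [Fintype K] [DecidableEq K]
    {lam : K → ℝ} {ψ : A × B → ℂ} {a : K → A → ℂ} {b : K → B → ℂ} (h : IsSchmidt lam ψ a b)
    (hlam : ∀ k, 0 < lam k) (n : ℕ) :
    IsSchmidt (fun k : Fin n → K => ∏ t, lam (k t))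
      (fun x : (Fin n → A) × (Fin n → B) => ∏ t, ψ (x.1 t, x.2 t))
      (fun k x => ∏ t, a (k t) (x t)) fun k y => ∏ t, b (k t) (y t) := by
  refine ⟨star_prod_dotProduct_prod h.left, star_prod_dotProduct_prod h.right, fun x => ?_⟩
  have h1 : ∀ k : Fin n → K, ((√(∏ t, lam (k t)) : ℝ) : ℂ) = ∏ t, ((√(lam (k t)) : ℝ) : ℂ) :=
    fun k => by rw [Real.sqrt_prod _ fun t _ => (hlam _).le, Complex.ofReal_prod]
  simp only [h1, ← Finset.prod_mul_distrib, h.eq]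
  exact (sum_prod_pi fun t k => ((√(lam k) : ℝ) : ℂ) * (a k (x.1 t) * b k (x.2 t))).symm

/-! ### Entropy and multiplicities of product weights -/

theorem sum_prod_mul_logb_prod {K : Type} [Fintype K] {lam : K → ℝ} (hlam : ∀ k, 0 < lam k)
    (hlam1 : ∑ k, lam k = 1) (n : ℕ) :
    ∑ k : Fin n → K, (∏ t, lam (k t)) * Real.logb 2 (∏ t, lam (k t)) =
      n * ∑ k, lam k * Real.logb 2 (lam k) := by
  have h1 : ∀ k : Fin n → K, (∏ t, lam (k t)) * Real.logb 2 (∏ t, lam (k t)) =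
      ∑ s, ∏ t, lam (k t) * (if t = s then Real.logb 2 (lam (k t)) else 1) := by
    intro k
    rw [Real.logb_prod _ _ fun t _ => (hlam _).ne', Finset.mul_sum]
    refine Finset.sum_congr rfl fun s _ => ?_
    rw [Finset.prod_mul_distrib, Finset.prod_ite_eq' Finset.univ s, if_pos (Finset.mem_univ _)]
  simp only [h1]
  rw [Finset.sum_comm]
  have h2 : ∀ s : Fin n, ∑ k : Fin n → K, ∏ t, lam (k t) *
      (if t = s then Real.logb 2 (lam (k t)) else 1) = ∑ k, lam k * Real.logb 2 (lam k) := by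
    intro s
    rw [sum_prod_pi fun t y => lam y * (if t = s then Real.logb 2 (lam y) else 1),
      Finset.prod_eq_single s (fun t _ ht => by simp [ht, hlam1]) (by simp)]
    simp
  rw [Finset.sum_congr rfl fun s _ => h2 s]
  simp

/-- The number of distinct products of `n` of the numbers `lam k` is polynomial in `n`. -/
theorem card_image_prod_le {K : Type} [Fintype K] [DecidableEq K] (lam : K → ℝ) (n : ℕ) :
    (Finset.univ.image fun k : Fin n → K => ∏ t, lam (k t)).card ≤ (n + 1) ^ Fintype.card K := by
  have h : (Finset.univ.image fun k : Fin n → K => ∏ t, lam (k t)) ⊆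
      Finset.univ.image fun c : K → Fin (n + 1) => ∏ x, lam x ^ (c x : ℕ) := by
    intro v hv
    obtain ⟨k, -, rfl⟩ := Finset.mem_image.1 hv
    -- The product depends only on the type of the sequence `k`, that is, on how often each symbol
    -- occurs.
    refine Finset.mem_image.2 ⟨fun x => ⟨(Finset.univ.filter fun t => k t = x).card, ?_⟩,
      Finset.mem_univ _, ?_⟩
    · exact Nat.lt_succ_of_le ((Finset.card_le_univ _).trans_eq (Fintype.card_fin n))
    · rw [← Finset.prod_fiberwise Finset.univ k fun t => lam (k t)]
      refine Finset.prod_congr rfl fun x _ => ?_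
      rw [Finset.prod_congr rfl fun t ht => by rw [(Finset.mem_filter.1 ht).2], Finset.prod_const]
  refine (Finset.card_le_card h).trans (Finset.card_image_le.trans_eq ?_)
  simp

/-- Each fibre of `f` contributes exactly `1`. -/
theorem sum_one_div_card_fiber {K R : Type*} [Fintype K] [DecidableEq R] (f : K → R) :
    ∑ k, (1 : ℝ) / (Finset.univ.filter fun l => f l = f k).card = (Finset.univ.image f).card := by
  rw [← Finset.sum_fiberwise_of_maps_to (t := Finset.univ.image f) (g := f)
    fun k hk => Finset.mem_image_of_mem f hk, Finset.card_eq_sum_ones, Nat.cast_sum]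
  refine Finset.sum_congr rfl fun v hv => ?_
  obtain ⟨k, -, rfl⟩ := Finset.mem_image.1 hv
  have hne : ((Finset.univ.filter fun l => f l = f k).card : ℝ) ≠ 0 :=
    Nat.cast_ne_zero.2 (Finset.card_ne_zero.2 ⟨k, by simp⟩)
  rw [Finset.sum_congr rfl fun l hl => by rw [(Finset.mem_filter.1 hl).2], Finset.sum_const,
    nsmul_eq_mul, Nat.cast_one, mul_one_div_cancel hne]

/-- The entropy exceeds the average logarithm of the multiplicities by at most the logarithm of
the number of distinct values. -/
theorem entropy_le_sum_mul_logb_card {K : Type} [Fintype K] {lam : K → ℝ} (hlam : ∀ k, 0 < lam k)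
    (hlam1 : ∑ k, lam k = 1) :
    -∑ k, lam k * Real.logb 2 (lam k) ≤
      ∑ k, lam k * Real.logb 2 (((Finset.univ.filter fun l => lam l = lam k).card + 1) / 2) +
        Real.logb 2 (Finset.univ.image lam).card + 1 := by
  have hl : 0 < Real.log 2 := Real.log_pos one_lt_two
  set c : K → ℝ := fun k => ((Finset.univ.filter fun l => lam l = lam k).card : ℝ) with hc
  have hc1 : ∀ k, 1 ≤ c k := fun k =>
    Nat.one_le_cast.2 (Finset.card_pos.2 ⟨k, by simp⟩)
  have hc0 : ∀ k, 0 < c k := fun k => one_pos.trans_le (hc1 k)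
  set N : ℝ := ((Finset.univ.image lam).card : ℝ) with hN
  have hN0 : 0 < N := by
    rw [hN, Nat.cast_pos, Finset.card_pos, Finset.image_nonempty]
    by_contra h
    rw [Finset.not_nonempty_iff_eq_empty] at h
    simp [h] at hlam1
  -- Gibbs' inequality against the weights `1 / (c_k N)`, uniform over the distinct values and then
  -- within each fibre, which sum to `1`. Replacing `c` by `(c + 1) / 2 ≥ c / 2` costs the `log 2`,
  -- hence the final `+ 1`.
  have hk : ∀ k, -(lam k * Real.log (lam k)) ≤
      lam k * Real.log ((c k + 1) / 2) + lam k * (Real.log N + Real.log 2) +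
        (1 / c k * (1 / N) - lam k) := by
    intro k
    have h1 : Real.log (c k / 2) ≤ Real.log ((c k + 1) / 2) :=
      Real.log_le_log (half_pos (hc0 k)) (by linarith)
    rw [Real.log_div (hc0 k).ne' two_ne_zero] at h1
    have h2 := Real.log_le_sub_one_of_pos
      (show 0 < 1 / (lam k * c k * N) from
        one_div_pos.2 (mul_pos (mul_pos (hlam k) (hc0 k)) hN0))
    rw [one_div, Real.log_inv, Real.log_mul (mul_pos (hlam k) (hc0 k)).ne' hN0.ne',
      Real.log_mul (hlam k).ne' (hc0 k).ne'] at h2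
    have h3 := mul_le_mul_of_nonneg_left h1 (hlam k).le
    have h4 := mul_le_mul_of_nonneg_left h2 (hlam k).le
    have h5 : lam k * ((lam k * c k * N)⁻¹ - 1) = 1 / c k * (1 / N) - lam k := by
      have := (hlam k).ne'
      have := (hc0 k).ne'
      field_simp
    rw [h5] at h4
    linarith
  have hsum := Finset.sum_le_sum fun k (_ : k ∈ Finset.univ) => hk k
  rw [Finset.sum_add_distrib, Finset.sum_add_distrib, Finset.sum_sub_distrib, ← Finset.sum_mul,
    ← Finset.sum_mul, hlam1, sum_one_div_card_fiber, ← hN, mul_one_div_cancel hN0.ne', one_mul,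
    Finset.sum_neg_distrib] at hsum
  simp only [Real.logb, mul_div_assoc', ← Finset.sum_div]
  rw [← neg_div, ← add_div, div_add_one hl.ne']
  refine div_le_div_of_nonneg_right ?_ hl.le
  linarith

theorem tendsto_logb_add_one_div : Tendsto (fun n : ℕ => Real.logb 2 (n + 1) / n) atTop (𝓝 0) := by
  have h := (Real.tendsto_pow_log_div_mul_add_atTop 1 (-1) 1 one_ne_zero).comp
    (tendsto_atTop_add_const_right atTop (1 : ℝ) tendsto_natCast_atTop_atTop)
  have h2 := h.div_const (Real.log 2)
  rw [zero_div] at h2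
  refine h2.congr fun n => ?_
  simp only [Function.comp_apply, pow_one, one_mul, add_neg_cancel_right, Real.logb]
  ring

theorem IsSchmidt.tendsto_measuredREE {A B K : Type} [Fintype A] [DecidableEq A] [Fintype B]
    [DecidableEq B] [Fintype K] [DecidableEq K] {lam : K → ℝ} {ψ : A × B → ℂ} {a : K → A → ℂ}
    {b : K → B → ℂ} (h : IsSchmidt lam ψ a b) (hlam : ∀ k, 0 < lam k) (hlam1 : ∑ k, lam k = 1)
    (C : MeasClass) :
    Tendsto (fun n : ℕ => measuredREE C (_root_.tensorPower (pureState ψ) n) / (n : EReal)) atTop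
      (𝓝 ((-∑ k, lam k * Real.logb 2 (lam k) : ℝ) : EReal)) := by
  set S := -∑ k, lam k * Real.logb 2 (lam k) with hS
  have hpos : ∀ (n : ℕ) (k : Fin n → K), 0 < ∏ t, lam (k t) := fun n k =>
    Finset.prod_pos fun t _ => hlam _
  have hsum : ∀ n : ℕ, ∑ k : Fin n → K, ∏ t, lam (k t) = 1 := fun n => by
    rw [sum_prod_pi fun _ y => lam y]
    simp [hlam1]
  have hent : ∀ n : ℕ, -∑ k : Fin n → K, (∏ t, lam (k t)) * Real.logb 2 (∏ t, lam (k t)) =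
      n * S := fun n => by
    rw [sum_prod_mul_logb_prod hlam hlam1, hS, mul_neg]
  have hup : ∀ n : ℕ, measuredREE C (_root_.tensorPower (pureState ψ) n) ≤
      ((n * S : ℝ) : EReal) := by
    intro n
    rw [tensorPower_pureState, ← hent]
    exact (h.tensorPower hlam n).measuredREE_le (hpos n) (hsum n) C
  have hlow : ∀ n : ℕ, ((n * S - (Fintype.card K * Real.logb 2 (n + 1) + 1) : ℝ) : EReal) ≤
      measuredREE C (_root_.tensorPower (pureState ψ) n) := by
    intro n
    rw [tensorPower_pureState]
    refine le_trans (EReal.coe_le_coe_iff.2 ?_)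
      ((h.tensorPower hlam n).le_measuredREE (hpos n) (hsum n) C)
    have h1 := entropy_le_sum_mul_logb_card (hpos n) (hsum n)
    rw [hent] at h1
    have h2 : Real.logb 2 (Finset.univ.image fun k : Fin n → K => ∏ t, lam (k t)).card ≤
        Fintype.card K * Real.logb 2 (n + 1) := by
      rw [← Real.logb_pow]
      refine Real.logb_le_logb_of_le one_lt_two ?_ ?_
      · rw [Nat.cast_pos, Finset.card_pos, Finset.image_nonempty]
        by_contra h0
        have := hsum n
        rw [Finset.not_nonempty_iff_eq_empty] at h0
        simp [h0] at this
      · exact_mod_cast card_image_prod_le lam n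
    linarith
  have hlim : Tendsto (fun n : ℕ => (n * S - (Fintype.card K * Real.logb 2 (n + 1) + 1)) / n)
      atTop (𝓝 S) := by
    have h1 : Tendsto (fun n : ℕ => S - (Fintype.card K * (Real.logb 2 (n + 1) / n) + 1 / n))
        atTop (𝓝 (S - (Fintype.card K * 0 + 0))) :=
      tendsto_const_nhds.sub ((tendsto_logb_add_one_div.const_mul _).add
        tendsto_one_div_atTop_nhds_zero_nat)
    rw [mul_zero, add_zero, sub_zero] at h1
    refine h1.congr' ?_
    filter_upwards [eventually_gt_atTop 0] with n hn
    have : (n : ℝ) ≠ 0 := Nat.cast_ne_zero.2 hn.ne'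
    field_simp
  refine tendsto_of_tendsto_of_tendsto_of_le_of_le'
    ((continuous_coe_real_ereal.tendsto S).comp hlim) tendsto_const_nhds
    (Eventually.of_forall fun n => ?_) ?_
  · rw [Function.comp_apply, EReal.coe_div]
    exact EReal.div_le_div_right_of_nonneg (EReal.coe_nonneg.2 (Nat.cast_nonneg n)) (hlow n)
  · filter_upwards [eventually_gt_atTop 0] with n hn
    refine (EReal.div_le_div_right_of_nonneg (EReal.coe_nonneg.2 (Nat.cast_nonneg n))
      (hup n)).trans_eq ?_
    rw [← EReal.coe_div, mul_div_cancel_left₀ _ (Nat.cast_ne_zero.2 hn.ne' : (n : ℝ) ≠ 0)]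

end

/-! ### The theorem -/

theorem proposition4 :
    (∀ (d : ℕ), 0 < d → ∀ C : MeasClass,
      measuredREE C (maxEntangled d) = ((Real.logb 2 ((d : ℝ) + 1) - 1 : ℝ) : EReal)) ∧
    (∀ (A B : Type) [Fintype A] [DecidableEq A] [Fintype B] [DecidableEq B] (ψ : A × B → ℂ),
      ∑ x, ‖ψ x‖ ^ 2 = 1 → ∀ C : MeasClass,
        Tendsto (fun n : ℕ => measuredREE C (tensorPower (pureState ψ) n) / (n : EReal)) atTop
          (𝓝 ((vonNeumannEntropy (traceB (pureState ψ)) : ℝ) : EReal))) := by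
  refine ⟨fun d hd C => (measuredREE_maxEntangled_le hd C).antisymm
    (le_measuredREE_maxEntangled hd C), ?_⟩
  intro A B _ _ _ _ ψ hψ C
  obtain ⟨K, _, _, lam, a, b, h, hlam, hlam1, hS⟩ := exists_isSchmidt hψ
  rw [hS]
  exact h.tendsto_measuredREE hlam hlam1 C
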